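/- Let $(\Omega,\mathcal F,\mathbb P)$ be an atomless probability space and let $\mathcal X$ be a linear subspace of $L^1(\Omega,\mathcal F,\mathbb P)$ that contains $L^\infty(\Omega,\mathcal F,\mathbb P)$ and is a Stonean vector lattice, i.e. $X\wedge Y,\ X\vee Y\in\mathcal X$ for all $X,Y\in\mathcal X$. Let $\rho:\mathcal X\to\mathbb R$ be a law-invariant coherent risk measure, i.e. for all $X,Y\in\mathcal X$, $m\in\mathbb R$ and $\lambda\ge 0$: $\rho(X)\ge\rho(Y)$ if $X\le Y$; $\rho(X+m)=\rho(X)-m$; $\rho(X+Y)\le\rho(X)+\rho(Y)$; $\rho(\lambda X)=\lambda\rho(X)$; and $\rho(X)=\rho(Y)$ if $X$ and $Y$ have the same law under $\mathbb P$. For $t\in[0,1]$ put $g_\rho(t):=\rho(-B_{1,t})$, where $B_{1,t}$ is a Bernoulli random variable with expectation $t$. Assume that (a) $\lim_{k\to\infty}\rho(-(X-k)^+)=0$ for all nonnegative $X\in\mathcal X$; (b) $\lim_{t\downarrow 0}g_\rho(t)=0$. A concave distortion function is a concave nondecreasing function $g:[0,1]\to[0,1]$ with $g(0)=0$ and $g(1)=1$.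 Let $F_X$ denote the distribution function of $X$. For a concave distortion function $g$ put $$\rho_g(X):=\int_{-\infty}^0 g(F_X(x))\,dx-\int_0^\infty\big(1-g(F_X(x))\big)\,dx$$ for all random variables $X$ with $\int_0^\infty g(1-F_{|X|}(x))\,dx<\infty$. Let $g'$ denote the right-sided derivative of $g$ on $(0,1)$. Then there is a set $\mathcal G_\rho$ of continuous concave distortion functions such that: (i) $\mathcal G_\rho$ is compact with respect to the uniform metric. (ii) $g_\rho(t)=\sup_{g\in\mathcal G_\rho}g(t)$ for all $t\in[0,1]$. (iii) For all $\gamma,t\in(0,1)$, the right-sided derivatives $g'(t)$, $g\in\mathcal G_\rho$, exist and $\sup_{g\in\mathcal G_\rho}g'(t)\le g_\rho(\gamma t)/(\gamma t)$. (iv) For every $X\in\mathcal X$ and every $g\in\mathcal G_\rho$, $\int_0^\infty g(1-F_{|X|}(x))\,dx<\infty$ and both integrals defining $\rho_g(X)$ are finite; moreover $\rho(X)=\sup_{g\in\mathcal G_\rho}\rho_g(X)$. (v) For every $X\in\mathcal X$, the map $\mathcal G_\rho\to\mathbb R$, $g\mapsto\rho_g(X)$, is lower semicontinuous with respect to the uniform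 metric, and it is continuous if in addition $\int_{-\infty}^0 g_\rho(\gamma F_X(x))\,dx<\infty$ for some $\gamma\in(0,1)$. -/

import Mathlib

open MeasureTheory ProbabilityTheory Set Filter Topology

namespace CoherentRisk

variable {Ω : Type*} [MeasurableSpace Ω] {P : Measure Ω}

/-- `P` is atomless: every measurable set of positive measure has a measurable subset of
strictly smaller positive measure. -/
def IsAtomless (P : Measure Ω) : Prop :=
  ∀ A : Set Ω, MeasurableSet A → 0 < P A →
    ∃ B ⊆ A, MeasurableSet B ∧ 0 < P B ∧ P B < P A

/-- The linear subspace `𝒳` of `L¹` contains `L^∞`. -/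
def ContainsLinfty (𝒳 : Submodule ℝ (Lp ℝ 1 P)) : Prop :=
  ∀ X : Lp ℝ 1 P, MemLp X ⊤ P → X ∈ 𝒳

/-- The linear subspace `𝒳` of `L¹` is stable under pointwise minima and maxima. -/
def IsStoneanLattice (𝒳 : Submodule ℝ (Lp ℝ 1 P)) : Prop :=
  ∀ X ∈ 𝒳, ∀ Y ∈ 𝒳, X ⊓ Y ∈ 𝒳 ∧ X ⊔ Y ∈ 𝒳

/-- Coherent risk measures. In `cash_invariant`, `Y` is the element `X + m` of `𝒳`. -/
structure IsCoherent (𝒳 : Submodule ℝ (Lp ℝ 1 P)) (ρ : 𝒳 → ℝ) : Prop where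
  antitone : ∀ X Y : 𝒳, (X : Lp ℝ 1 P) ≤ (Y : Lp ℝ 1 P) → ρ Y ≤ ρ X
  cash_invariant : ∀ (X Y : 𝒳) (m : ℝ),
    ((Y : Lp ℝ 1 P) : Ω → ℝ) =ᵐ[P] (fun ω => (X : Lp ℝ 1 P) ω + m) → ρ Y = ρ X - m
  subadditive : ∀ X Y : 𝒳, ρ (X + Y) ≤ ρ X + ρ Y
  pos_homogeneous : ∀ (X : 𝒳) (c : ℝ), 0 ≤ c → ρ (c • X) = c * ρ X

/-- `ρ` depends only on the law of its argument under `P`. -/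
def IsLawInvariant (𝒳 : Submodule ℝ (Lp ℝ 1 P)) (ρ : 𝒳 → ℝ) : Prop :=
  ∀ X Y : 𝒳, P.map (X : Lp ℝ 1 P) = P.map (Y : Lp ℝ 1 P) → ρ X = ρ Y

/-- `B` is a Bernoulli random variable with expectation `t`. -/
def IsBernoulliVar (B : Lp ℝ 1 P) (t : ℝ) : Prop :=
  (∀ᵐ ω ∂P, B ω = 0 ∨ B ω = 1) ∧ ∫ ω, B ω ∂P = t

open scoped Classical in
/-- The distortion function `g_ρ(t) = ρ(-B)` associated with `ρ`, where `B` is a Bernoulli random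
variable with expectation `t`. On an atomless probability space such a `B` exists for each
`t ∈ [0,1]`, and for a law-invariant `ρ` the value does not depend on the choice of `B`
(see `assocDistortion_eq`). -/
noncomputable def assocDistortion (𝒳 : Submodule ℝ (Lp ℝ 1 P)) (ρ : 𝒳 → ℝ) (t : ℝ) : ℝ :=
  if h : ∃ B : 𝒳, IsBernoulliVar (B : Lp ℝ 1 P) t then ρ (-h.choose) else 0

/-- Two Bernoulli variables with the same expectation have the same negated law. -/
theorem IsBernoulliVar.map_neg_eq [IsProbabilityMeasure P] {B C : Lp ℝ 1 P} {t : ℝ}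
    (hB : IsBernoulliVar B t) (hC : IsBernoulliVar C t) :
    P.map (-B : Lp ℝ 1 P) = P.map (-C : Lp ℝ 1 P) := by
  have key : ∀ D : Lp ℝ 1 P, IsBernoulliVar D t → ∀ s : Set ℝ, MeasurableSet s →
      (P.map (-D : Lp ℝ 1 P)).real s
        = s.indicator 1 (0 : ℝ) * (1 - t) + s.indicator 1 (-1 : ℝ) * t := by
    intro D hD s hs
    have hint : Integrable D P := L1.integrable_coeFn D
    have h1 : (P.map (-D : Lp ℝ 1 P)).real s
        = ∫ ω, s.indicator (1 : ℝ → ℝ) ((-D : Lp ℝ 1 P) ω) ∂P := by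
      rw [← integral_indicator_one hs, integral_map (Lp.aestronglyMeasurable _).aemeasurable]
      exact (measurable_one.indicator hs).aestronglyMeasurable
    have h2 : (fun ω => s.indicator (1 : ℝ → ℝ) ((-D : Lp ℝ 1 P) ω)) =ᵐ[P]
        fun ω => s.indicator 1 (0 : ℝ) * (1 - D ω) + s.indicator 1 (-1 : ℝ) * D ω := by
      filter_upwards [hD.1, Lp.coeFn_neg D] with ω h h'
      rw [h', Pi.neg_apply]
      rcases h with h | h <;> simp [h]
    rw [h1, integral_congr_ae h2, integral_add, integral_const_mul, integral_const_mul,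
      integral_sub (integrable_const _) hint, hD.2]
    · simp
    · exact ((integrable_const _).sub hint).const_mul _
    · exact hint.const_mul _
  have := Measure.isProbabilityMeasure_map (μ := P)
    (Lp.aestronglyMeasurable (-B : Lp ℝ 1 P)).aemeasurable
  have := Measure.isProbabilityMeasure_map (μ := P)
    (Lp.aestronglyMeasurable (-C : Lp ℝ 1 P)).aemeasurable
  ext s hs
  rw [← measureReal_eq_measureReal_iff, key B hB s hs, key C hC s hs]

theorem assocDistortion_eq [IsProbabilityMeasure P] {𝒳 : Submodule ℝ (Lp ℝ 1 P)} {ρ : 𝒳 → ℝ}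
    (hρ : IsLawInvariant 𝒳 ρ) {t : ℝ} (B : 𝒳) (hB : IsBernoulliVar (B : Lp ℝ 1 P) t) :
    assocDistortion 𝒳 ρ t = ρ (-B) := by
  have h : ∃ B : 𝒳, IsBernoulliVar (B : Lp ℝ 1 P) t := ⟨B, hB⟩
  rw [assocDistortion, dif_pos h]
  exact hρ _ _ (h.choose_spec.map_neg_eq hB)

/-- Condition (a): `ρ(-(X - k)⁺) → 0` for all nonnegative `X ∈ 𝒳`. Here `Y k` is the
element `(X - k)⁺` of `𝒳`. -/
def TailCondition (𝒳 : Submodule ℝ (Lp ℝ 1 P)) (ρ : 𝒳 → ℝ) : Prop :=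
  ∀ (X : 𝒳) (Y : ℕ → 𝒳), 0 ≤ (X : Lp ℝ 1 P) →
    (∀ k : ℕ, ((Y k : Lp ℝ 1 P) : Ω → ℝ) =ᵐ[P] fun ω => max ((X : Lp ℝ 1 P) ω - k) 0) →
    Tendsto (fun k => ρ (-Y k)) atTop (𝓝 0)

/-- The extension of a function `g` on `[0,1]` to `ℝ` by `g 0` on the left, `g 1` on the right. -/
noncomputable def ext01 (g : unitInterval → ℝ) : ℝ → ℝ :=
  IccExtend (zero_le_one' ℝ) g

/-- Concave distortion functions: `g : [0,1] → ℝ` is nondecreasing and concave with `g 0 = 0` and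
`g 1 = 1` (hence with values in `[0,1]`). -/
structure IsConcaveDistortion (g : unitInterval → ℝ) : Prop where
  monotone : Monotone g
  map_zero : g 0 = 0
  map_one : g 1 = 1
  concave : ConcaveOn ℝ (Icc 0 1) (ext01 g)

/-- The distribution function `F_X` of a real random variable `X` under `P`. -/
noncomputable def distFun (P : Measure Ω) (X : Ω → ℝ) (x : ℝ) : ℝ :=
  cdf (P.map X) x

/-- The distortion risk measure
`ρ_g(X) = ∫_{-∞}^0 g(F_X(x)) dx - ∫_0^∞ (1 - g(F_X(x))) dx`. -/
noncomputable def distortionRisk (P : Measure Ω) (g : unitInterval → ℝ) (X : Ω → ℝ) : ℝ :=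
  (∫ x in Iic (0 : ℝ), ext01 g (distFun P X x)) -
    ∫ x in Ioi (0 : ℝ), (1 - ext01 g (distFun P X x))

/-- `X` belongs to the domain of `ρ_g`: `∫_0^∞ g(1 - F_{|X|}(x)) dx < ∞`, and both integrals
defining `ρ_g(X)` converge. -/
def InDistortionDomain (P : Measure Ω) (g : unitInterval → ℝ) (X : Ω → ℝ) : Prop :=
  IntegrableOn (fun x => ext01 g (1 - distFun P (fun ω => |X ω|) x)) (Ioi 0) ∧
  IntegrableOn (fun x => ext01 g (distFun P X x)) (Iic 0) ∧
  IntegrableOn (fun x => 1 - ext01 g (distFun P X x)) (Ioi 0)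

end CoherentRisk

open CoherentRisk

open scoped ENNReal

namespace CoherentRisk

variable {Ω : Type*} [MeasurableSpace Ω] {P : Measure Ω}

/-! The set `G` is `dominatedDistortions`: all continuous concave distortions `g` whose truncated
Choquet integrals `∫_0^M g(P(Y > x)) dx` are at most `ρ(-Y)` for every nonnegative `Y` in `𝒳`. The
point is that each value `ρ X` is attained by some such `g`.

Hahn–Banach gives a linear `ℓ ≤ ρ(-·)` with `ℓ X = -ρ X` (`IsCoherent.exists_dominated_linear`). On
indicators `ℓ` is additive and at most `g_ρ(P A)`, so by (b) it is a probability measure `ν` with a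
density `Z`. Let `g t` be the largest `ν`-mass of a set of probability `t`; by a Neyman–Pearson
argument it is attained on upper level sets of `Z`, and `g` is concave
(`exists_distortion_withDensity`). Approximate `Y` by a staircase along its level sets and replace
these by nested upper level sets of `Z` with the same probabilities. The law is unchanged, so law
invariance gives the domination of `g`, while `ν A ≤ g(P A)` bounds `ℓ Y` from above up to the tail
`(Y - M)⁺` (`exists_isDominated_of_linear`). Applied to `(m - X)⁺`, with (a) removing the tails,
this yields `ρ X ≤ ρ_g(X)`; domination gives the reverse inequality for every `g` in `G`.

Testing domination on indicators gives `g ≤ g_ρ`. A concave distortion is subadditive, hence is its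
own modulus of continuity; so `g_ρ` is a common modulus, and Arzelà–Ascoli gives compactness. The
derivative bound and the majorant for continuity both come from `γ g(t) ≤ g(γ t) ≤ g_ρ(γ t)`. -/

/-! ### Atomless measures and Sierpiński's theorem. -/

theorem IsAtomless.exists_subset_real_le_half [IsFiniteMeasure P] (hP : IsAtomless P) {A : Set Ω}
    (hA : MeasurableSet A) (hpos : 0 < P.real A) :
    ∃ B ⊆ A, MeasurableSet B ∧ 0 < P.real B ∧ P.real B ≤ P.real A / 2 := by
  obtain ⟨B, hBA, hB, h0, h1⟩ := hP A hA (by simpa [measureReal_def, ENNReal.toReal_pos_iff] using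
    hpos)
  have h0' : 0 < P.real B := ENNReal.toReal_pos h0.ne' (measure_ne_top _ _)
  have h1' : P.real B < P.real A :=
    (ENNReal.toReal_lt_toReal (measure_ne_top _ _) (measure_ne_top _ _)).2 h1
  have hd : P.real (A \ B) = P.real A - P.real B := measureReal_sdiff hBA hB
  rcases le_total (P.real B) (P.real A / 2) with h | h
  · exact ⟨B, hBA, hB, h0', h⟩
  · exact ⟨A \ B, sdiff_subset, hA.diff hB, by linarith, by linarith⟩

theorem IsAtomless.exists_subset_real_lt [IsFiniteMeasure P] (hP : IsAtomless P) {A : Set Ω}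
    (hA : MeasurableSet A) (hpos : 0 < P.real A) {ε : ℝ} (hε : 0 < ε) :
    ∃ B ⊆ A, MeasurableSet B ∧ 0 < P.real B ∧ P.real B < ε := by
  have key : ∀ n : ℕ, ∃ B ⊆ A, MeasurableSet B ∧ 0 < P.real B ∧
      P.real B ≤ P.real A * (1 / 2) ^ n := by
    intro n
    induction n with
    | zero => exact ⟨A, Subset.rfl, hA, hpos, by simp⟩
    | succ n ih =>
      obtain ⟨B, hBA, hB, h0, h1⟩ := ih
      obtain ⟨C, hCB, hC, h2, h3⟩ := hP.exists_subset_real_le_half hB h0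
      exact ⟨C, hCB.trans hBA, hC, h2, by rw [pow_succ]; linarith⟩
  have ht : Tendsto (fun n : ℕ => P.real A * (1 / 2 : ℝ) ^ n) atTop (𝓝 (P.real A * 0)) :=
    (tendsto_pow_atTop_nhds_zero_of_lt_one (by norm_num) (by norm_num)).const_mul _
  rw [mul_zero] at ht
  obtain ⟨n, hn⟩ := (ht.eventually_lt_const hε).exists
  obtain ⟨B, hBA, hB, h0, h1⟩ := key n
  exact ⟨B, hBA, hB, h0, h1.trans_lt hn⟩

/-- Sierpiński's theorem: an atomless finite measure takes all intermediate values. -/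
theorem IsAtomless.exists_between_real_eq [IsFiniteMeasure P] (hP : IsAtomless P) {L U : Set Ω}
    (hL : MeasurableSet L) (hU : MeasurableSet U) (hLU : L ⊆ U) {s : ℝ} (hLs : P.real L ≤ s)
    (hsU : s ≤ P.real U) :
    ∃ B, MeasurableSet B ∧ L ⊆ B ∧ B ⊆ U ∧ P.real B = s := by
  let S : Set (Set Ω) := {C | MeasurableSet C ∧ L ⊆ C ∧ C ⊆ U ∧ P.real C ≤ s}
  -- Greedy choice: `C'` realizes at least half of the gain in measure still available above `C`
  -- within `S`.
  have step : ∀ C : S, ∃ C' : S, C.1 ⊆ C'.1 ∧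
      ∀ E ∈ S, C.1 ⊆ E → P.real E + P.real C.1 ≤ 2 * P.real C'.1 := by
    rintro ⟨C, hC⟩
    let V : Set ℝ := P.real '' {E | E ∈ S ∧ C ⊆ E}
    have hVne : V.Nonempty := ⟨_, C, ⟨hC, Subset.rfl⟩, rfl⟩
    have hVb : BddAbove V := ⟨s, by rintro _ ⟨E, ⟨hE, -⟩, rfl⟩; exact hE.2.2.2⟩
    have hCV : P.real C ≤ sSup V := le_csSup hVb ⟨C, ⟨hC, Subset.rfl⟩, rfl⟩
    rcases hCV.eq_or_lt with h | h
    · refine ⟨⟨C, hC⟩, Subset.rfl, fun E hE hCE => ?_⟩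
      have := le_csSup hVb ⟨E, ⟨hE, hCE⟩, rfl⟩
      simp only
      linarith
    · obtain ⟨_, ⟨C', ⟨hC', hCC'⟩, rfl⟩, hlt⟩ :=
        exists_lt_of_lt_csSup hVne (show (sSup V + P.real C) / 2 < sSup V by linarith)
      refine ⟨⟨C', hC'⟩, hCC', fun E hE hCE => ?_⟩
      have := le_csSup hVb ⟨E, ⟨hE, hCE⟩, rfl⟩
      simp only
      linarith
  choose nxt hsub hbig using step
  let C : ℕ → S := fun n => Nat.rec ⟨L, hL, Subset.rfl, hLU, hLs⟩ (fun _ D => nxt D) n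
  have hCs : ∀ n, C (n + 1) = nxt (C n) := fun _ => rfl
  have hmono : Monotone fun n => (C n).1 := monotone_nat_of_le_succ fun n => hsub (C n)
  let B : Set Ω := ⋃ n, (C n).1
  have hBm : MeasurableSet B := MeasurableSet.iUnion fun n => (C n).2.1
  have hlim : Tendsto (fun n => P.real (C n).1) atTop (𝓝 (P.real B)) :=
    (ENNReal.tendsto_toReal (measure_ne_top _ _)).comp (tendsto_measure_iUnion_atTop hmono)
  have hBU : B ⊆ U := iUnion_subset fun n => (C n).2.2.2.1
  have hLB : L ⊆ B := subset_iUnion (fun n => (C n).1) 0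
  have hBs : P.real B ≤ s := le_of_tendsto' hlim fun n => (C n).2.2.2.2
  refine ⟨B, hBm, hLB, hBU, hBs.antisymm ?_⟩
  -- If `B` fell short of `s`, a small `D` outside `B` would keep `B ∪ D` admissible at every stage;
  -- the limit of the greedy inequality then forces `P (B ∪ D) ≤ P B`.
  by_contra! hlt
  have hd : P.real (U \ B) = P.real U - P.real B := measureReal_sdiff hBU hBm
  obtain ⟨D, hDU, hD, h0, h1⟩ := hP.exists_subset_real_lt (hU.diff hBm)
    (show 0 < P.real (U \ B) by linarith) (show 0 < s - P.real B by linarith)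
  have hBD : P.real (B ∪ D) = P.real B + P.real D :=
    measureReal_union (disjoint_sdiff_right.mono_right hDU) hD
  have hES : B ∪ D ∈ S := ⟨hBm.union hD, hLB.trans subset_union_left,
    union_subset hBU (hDU.trans sdiff_subset), by linarith⟩
  have hineq : ∀ n, P.real (B ∪ D) + P.real (C n).1 ≤ 2 * P.real (C (n + 1)).1 := fun n =>
    hbig (C n) _ hES ((subset_iUnion (fun n => (C n).1) n).trans subset_union_left)
  have := le_of_tendsto_of_tendsto' (hlim.const_add _)
    ((hlim.comp (tendsto_add_atTop_nat 1)).const_mul 2) hineq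
  linarith

/-! ### Upper level sets of a density and the distortion they define. -/

/-- `B` is an upper level set of `Z`, up to the choice of a part of `{Z = z}`. -/
def IsUpperLevel (Z : Ω → ℝ≥0∞) (B : Set Ω) : Prop :=
  MeasurableSet B ∧ ∃ z : ℝ≥0∞, {ω | z < Z ω} ⊆ B ∧ B ⊆ {ω | z ≤ Z ω}

theorem isUpperLevel_univ (Z : Ω → ℝ≥0∞) : IsUpperLevel Z univ :=
  ⟨MeasurableSet.univ, 0, subset_univ _, fun ω _ => show 0 ≤ Z ω from zero_le⟩

/-- The infimum of the levels `z` with `P(Z > z) ≤ s` works: continuity of `P` from below gives the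
first bound, continuity from above the second. -/
theorem exists_quantile [IsProbabilityMeasure P] {Z : Ω → ℝ≥0∞} (hZ : Measurable Z) {s : ℝ}
    (h0 : 0 ≤ s) (h1 : s ≤ 1) :
    ∃ z : ℝ≥0∞, P.real {ω | z < Z ω} ≤ s ∧ s ≤ P.real {ω | z ≤ Z ω} := by
  let S : Set ℝ≥0∞ := {z | P.real {ω | z < Z ω} ≤ s}
  have hne : S.Nonempty := ⟨∞, by simpa [S] using h0⟩
  refine ⟨sInf S, ?_, ?_⟩
  · obtain ⟨u, hu, hlim, huS⟩ := exists_seq_tendsto_sInf hne (OrderBot.bddBelow S)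
    have hset : {ω | sInf S < Z ω} = ⋃ n, {ω | u n < Z ω} := by
      ext ω
      simp only [mem_ofPred_eq, mem_iUnion]
      exact ⟨fun h => (hlim.eventually_lt_const h).exists,
        fun ⟨n, hn⟩ => (sInf_le (huS n)).trans_lt hn⟩
    have hmono : Monotone fun n => {ω | u n < Z ω} := fun m n hmn ω hω => (hu hmn).trans_lt hω
    rw [hset]
    exact le_of_tendsto' ((ENNReal.tendsto_toReal (measure_ne_top P _)).comp
      (tendsto_measure_iUnion_atTop hmono)) huS
  · rcases eq_or_ne (sInf S) 0 with h | h
    · simpa [h] using h1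
    · obtain ⟨u, hu, hlt, hlim⟩ := exists_seq_strictMono_tendsto' (pos_iff_ne_zero.2 h)
      have hset : {ω | sInf S ≤ Z ω} = ⋂ n, {ω | u n < Z ω} := by
        ext ω
        simp only [mem_ofPred_eq, mem_iInter]
        exact ⟨fun h n => (hlt n).2.trans_le h, fun h => le_of_tendsto' hlim fun n => (h n).le⟩
      have hanti : Antitone fun n => {ω | u n < Z ω} :=
        fun m n hmn ω hω => (hu.monotone hmn).trans_lt hω
      rw [hset]
      refine ge_of_tendsto' ((ENNReal.tendsto_toReal (measure_ne_top P _)).comp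
        (tendsto_measure_iInter_atTop
          (fun n => (measurableSet_lt measurable_const hZ).nullMeasurableSet) hanti
          ⟨0, measure_ne_top _ _⟩)) fun n => ?_
      by_contra! hn
      exact (sInf_le (show u n ∈ S from hn.le)).not_gt (hlt n).2

/-- Cut at the larger of the level of `B` and the `s`-quantile level of `Z`; Sierpiński's theorem
supplies the part of the level set needed to hit `s` exactly. Iterating this produces nested level
sets. -/
theorem IsUpperLevel.exists_subset [IsProbabilityMeasure P] (hP : IsAtomless P) {Z : Ω → ℝ≥0∞}
    (hZ : Measurable Z) {B : Set Ω} (hB : IsUpperLevel Z B) {s : ℝ} (h0 : 0 ≤ s)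
    (hs : s ≤ P.real B) :
    ∃ C ⊆ B, IsUpperLevel Z C ∧ P.real C = s := by
  obtain ⟨hBm, z, hz, hz'⟩ := hB
  obtain ⟨w, hw, hw'⟩ := exists_quantile (P := P) hZ h0 (hs.trans measureReal_le_one)
  have hlt : ∀ v, MeasurableSet {ω | v < Z ω} := fun v => measurableSet_lt measurable_const hZ
  have hle : ∀ v, MeasurableSet {ω | v ≤ Z ω} := fun v => measurableSet_le measurable_const hZ
  have hsub : {ω | max z w < Z ω} ⊆ B := fun ω hω => hz ((le_max_left z w).trans_lt hω)
  obtain ⟨C, hC, h1, h2, h3⟩ := hP.exists_between_real_eq (s := s) (hlt (max z w))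
    (hBm.inter (hle (max z w)))
    (subset_inter hsub fun ω hω => show _ ≤ _ from (show max z w < Z ω from hω).le)
    ((measureReal_mono fun ω hω => (le_max_right z w).trans_lt hω).trans hw) (by
      rcases le_or_gt w z with h | h
      · rwa [max_eq_left h, inter_eq_left.2 hz']
      · rw [max_eq_right h.le, inter_eq_right.2]
        · exact hw'
        · exact fun ω hω => hz (h.trans_le hω))
  exact ⟨C, h2.trans inter_subset_left, ⟨hC, max z w, h1, h2.trans inter_subset_right⟩, h3⟩

theorem exists_antitone_isUpperLevel [IsProbabilityMeasure P] (hP : IsAtomless P)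
    {Z : Ω → ℝ≥0∞} (hZ : Measurable Z) {s : ℕ → ℝ} (hs : Antitone s) (h0 : ∀ i, 0 ≤ s i)
    (h1 : s 0 ≤ 1) :
    ∃ B : ℕ → Set Ω, Antitone B ∧ ∀ i, IsUpperLevel Z (B i) ∧ P.real (B i) = s i := by
  obtain ⟨B₀, -, hB₀, hB₀s⟩ := (isUpperLevel_univ Z).exists_subset hP hZ (h0 0) (by simpa using h1)
  have step : ∀ (i : ℕ) (B : {B : Set Ω // IsUpperLevel Z B ∧ P.real B = s i}),
      ∃ C : {B : Set Ω // IsUpperLevel Z B ∧ P.real B = s (i + 1)}, C.1 ⊆ B.1 := by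
    rintro i ⟨B, hB, hBs⟩
    obtain ⟨C, hCB, hC, hCs⟩ := hB.exists_subset hP hZ (h0 (i + 1))
      ((hs (Nat.le_succ i)).trans hBs.ge)
    exact ⟨⟨C, hC, hCs⟩, hCB⟩
  choose nxt hnxt using step
  let B : (i : ℕ) → {B : Set Ω // IsUpperLevel Z B ∧ P.real B = s i} :=
    fun i => Nat.rec ⟨B₀, hB₀, hB₀s⟩ (fun i C => nxt i C) i
  exact ⟨fun i => (B i).1, antitone_nat_of_succ_le fun i => hnxt i (B i), fun i => (B i).2⟩

/-- Neyman–Pearson exchange: the density is at most `z` on `A \ B` and at least `z` on `B \ A`. The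
number `r = z` later serves as the slope of a supporting line of the distortion at `P B`. -/
theorem IsUpperLevel.withDensity_exchange [IsFiniteMeasure P] {Z : Ω → ℝ≥0∞}
    [IsFiniteMeasure (P.withDensity Z)] {B : Set Ω} (hB : IsUpperLevel Z B)
    (hpos : 0 < P.real B) :
    ∃ r : ℝ, 0 ≤ r ∧ ∀ A, MeasurableSet A →
      (P.withDensity Z).real A - (P.withDensity Z).real B ≤ r * (P.real A - P.real B) := by
  obtain ⟨hBm, z, hz, hz'⟩ := hB
  have hlow : ∀ C, MeasurableSet C → C ⊆ B → z * P C ≤ P.withDensity Z C := fun C hC hCB => by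
    rw [withDensity_apply _ hC, ← setLIntegral_const]
    exact setLIntegral_mono' hC fun ω hω => hz' (hCB hω)
  have hup : ∀ C, MeasurableSet C → Disjoint C B → P.withDensity Z C ≤ z * P C :=
    fun C hC hCB => by
      rw [withDensity_apply _ hC, ← setLIntegral_const]
      refine setLIntegral_mono' hC fun ω hω => ?_
      by_contra! h
      exact disjoint_left.1 hCB hω (hz h)
  have hz_top : z ≠ ∞ := by
    rintro rfl
    have := hlow B hBm Subset.rfl
    rw [ENNReal.top_mul fun h => hpos.ne' (by simp [measureReal_def, h])] at this
    exact measure_ne_top _ _ (top_le_iff.1 this)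
  refine ⟨z.toReal, ENNReal.toReal_nonneg, fun A hA => ?_⟩
  have e1 := ENNReal.toReal_mono (by finiteness) (hup (A \ B) (hA.diff hBm) disjoint_sdiff_left)
  have e2 := ENNReal.toReal_mono (measure_ne_top _ _) (hlow (B \ A) (hBm.diff hA) sdiff_subset)
  rw [ENNReal.toReal_mul] at e1 e2
  simp only [← measureReal_def] at e1 e2
  have h1 := measureReal_sdiff_add_inter (μ := P) (s := A) hBm
  have h2 := measureReal_sdiff_add_inter (μ := P) (s := B) hA
  have h3 := measureReal_sdiff_add_inter (μ := P.withDensity Z) (s := A) hBm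
  have h4 := measureReal_sdiff_add_inter (μ := P.withDensity Z) (s := B) hA
  rw [inter_comm] at h2 h4
  have : P.real A - P.real B = P.real (A \ B) - P.real (B \ A) := by linarith
  rw [this]
  linarith

theorem ext01_of_mem {g : unitInterval → ℝ} {x : ℝ} (hx : x ∈ Icc (0 : ℝ) 1) :
    ext01 g x = g ⟨x, hx⟩ :=
  IccExtend_of_mem _ _ hx

/-- The distortion function of a probability measure `Z dP`: its value at `t` is the largest mass
of a set of `P`-probability `t`, which is attained at the upper level sets of `Z`. -/
theorem exists_distortion_withDensity [IsProbabilityMeasure P] (hP : IsAtomless P)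
    {Z : Ω → ℝ≥0∞} (hZ : Measurable Z) [IsProbabilityMeasure (P.withDensity Z)] :
    ∃ g : unitInterval → ℝ, IsConcaveDistortion g ∧
      (∀ A, MeasurableSet A → (P.withDensity Z).real A ≤ ext01 g (P.real A)) ∧
      ∀ B, IsUpperLevel Z B → (P.withDensity Z).real B = ext01 g (P.real B) := by
  set ν := P.withDensity Z with hν
  have hac : ∀ {B : Set Ω}, P.real B = 0 → ν.real B = 0 := fun {B} h => by
    rw [measureReal_eq_zero_iff] at h ⊢
    exact withDensity_absolutelyContinuous P Z h
  choose B _ hB hBt using fun t : unitInterval =>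
    (isUpperLevel_univ Z).exists_subset (P := P) hP hZ t.2.1 (by simpa using t.2.2)
  have hmax : ∀ {A C : Set Ω}, MeasurableSet A → IsUpperLevel Z C → P.real A ≤ P.real C →
      ν.real A ≤ ν.real C := by
    intro A C hA hC h
    rcases (measureReal_nonneg (μ := P) (s := C)).eq_or_lt with h0 | h0
    · rw [hac h0.symm, hac (le_antisymm (h.trans h0.ge) measureReal_nonneg)]
    · obtain ⟨r, hr, H⟩ := hC.withDensity_exchange h0
      nlinarith [H A hA]
  have hmem : ∀ A, P.real A ∈ Icc (0 : ℝ) 1 := fun A => ⟨measureReal_nonneg, measureReal_le_one⟩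
  refine ⟨fun t => ν.real (B t), ⟨?_, ?_, ?_, ?_⟩, ?_, ?_⟩
  · intro s t hst
    exact hmax (hB s).1 (hB t) (by rw [hBt, hBt]; exact hst)
  · exact hac (hBt 0)
  · refine le_antisymm measureReal_le_one ?_
    rw [← probReal_univ (μ := ν)]
    exact hmax MeasurableSet.univ (hB 1) (by rw [hBt]; simp)
  · refine ⟨convex_Icc 0 1, fun x hx y hy a b ha hb hab => ?_⟩
    have hu := (convex_Icc (0 : ℝ) 1) hx hy ha hb hab
    rw [ext01_of_mem hx, ext01_of_mem hy, ext01_of_mem hu]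
    simp only [smul_eq_mul] at hu ⊢
    -- The exchange inequality needs a set of positive probability, so the midpoint `0` is treated
    -- apart.
    rcases hu.1.eq_or_lt with h0 | h0
    · have hax : a * x = 0 := by nlinarith [mul_nonneg ha hx.1, mul_nonneg hb hy.1]
      have hby : b * y = 0 := by nlinarith [mul_nonneg ha hx.1, mul_nonneg hb hy.1]
      have hz : ∀ (c w : ℝ) (hw : w ∈ Icc (0 : ℝ) 1), c * w = 0 → c * ν.real (B ⟨w, hw⟩) = 0 := by
        intro c w hw h
        rcases mul_eq_zero.1 h with h | h
        · simp [h]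
        · rw [hac ((hBt ⟨w, hw⟩).trans h), mul_zero]
      rw [hz a x hx hax, hz b y hy hby, add_zero]
      exact measureReal_nonneg
    -- One slope at the intermediate point bounds the masses at both `x` and `y`; averaging cancels
    -- the linear terms.
    · obtain ⟨r, hr, H⟩ := (hB ⟨a * x + b * y, hu⟩).withDensity_exchange (P := P)
        (by rw [hBt]; exact h0)
      have hx' := H _ (hB ⟨x, hx⟩).1
      have hy' := H _ (hB ⟨y, hy⟩).1
      simp only [hBt, ← hν] at hx' hy'
      have e1 := mul_le_mul_of_nonneg_left hx' ha
      have e2 := mul_le_mul_of_nonneg_left hy' hb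
      have hb' : b = 1 - a := by linarith
      subst hb'
      nlinarith
  · intro A hA
    rw [ext01_of_mem (hmem A)]
    exact hmax hA (hB _) (by rw [hBt])
  · intro C hC
    rw [ext01_of_mem (hmem C)]
    exact (hmax hC.1 (hB _) (by rw [hBt])).antisymm (hmax (hB _).1 hC (by rw [hBt]))

/-! ### Staircases along decreasing sets. -/

/-- The step function with step height `c` along the decreasing sets `A 0, …, A (n - 1)`. -/
noncomputable def stair {α : Type*} (A : ℕ → Set α) (n : ℕ) (c : ℝ) (ω : α) : ℝ :=
  ∑ i ∈ Finset.range n, (A i).indicator (fun _ => c) ω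

theorem measurable_stair {A : ℕ → Set Ω} (hA : ∀ i, MeasurableSet (A i)) (n : ℕ) (c : ℝ) :
    Measurable (stair A n c) :=
  Finset.measurable_fun_sum _ fun i _ => measurable_const.indicator (hA i)

/-- The sets decrease, so the indices `i < n` with `ω ∈ A i` form an initial segment, and the
staircase is `c` times its length. -/
theorem stair_gt_iff {α : Type*} {A : ℕ → Set α} (hA : Antitone A) (n : ℕ) {c : ℝ}
    (hc : 0 < c) {x : ℝ} (hx : 0 ≤ x) (ω : α) :
    x < stair A n c ω ↔ ⌊x / c⌋₊ < n ∧ ω ∈ A ⌊x / c⌋₊ := by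
  classical
  set k := ⌊x / c⌋₊ with hk
  have hN : stair A n c ω = ((Finset.range n).filter (fun i => ω ∈ A i)).card * c := by
    simp [stair, indicator_apply, ← Finset.sum_filter]
  have h1 : x < stair A n c ω ↔ k < ((Finset.range n).filter (fun i => ω ∈ A i)).card := by
    rw [hN, hk, Nat.floor_lt (div_nonneg hx hc.le), div_lt_iff₀ hc]
  rw [h1]
  constructor
  · intro h
    by_contra hcon
    have hsub : (Finset.range n).filter (fun i => ω ∈ A i) ⊆ Finset.range k := by
      intro i hi
      simp only [Finset.mem_filter, Finset.mem_range] at hi ⊢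
      by_contra! hki
      exact hcon ⟨hki.trans_lt hi.1, hA hki hi.2⟩
    have := Finset.card_le_card hsub
    rw [Finset.card_range] at this
    omega
  · rintro ⟨h, hω⟩
    have hsub : Finset.range (k + 1) ⊆ (Finset.range n).filter (fun i => ω ∈ A i) := by
      intro i hi
      simp only [Finset.mem_filter, Finset.mem_range] at hi ⊢
      exact ⟨by omega, hA (by omega) hω⟩
    have := Finset.card_le_card hsub
    rw [Finset.card_range] at this
    omega

theorem stair_nonneg {α : Type*} (A : ℕ → Set α) (n : ℕ) {c : ℝ} (hc : 0 ≤ c) (ω : α) : 0 ≤ stair A n c ω :=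
  Finset.sum_nonneg fun _ _ => indicator_nonneg (fun _ _ => hc) ω

/-- Every tail probability of a staircase is `0`, `1` or some `P (A i)`, so the law depends only on
these numbers. This is where law invariance will enter. -/
theorem map_stair_eq [IsProbabilityMeasure P] {A B : ℕ → Set Ω} (hA : Antitone A)
    (hB : Antitone B) (hAm : ∀ i, MeasurableSet (A i)) (hBm : ∀ i, MeasurableSet (B i))
    (h : ∀ i, P.real (A i) = P.real (B i)) (n : ℕ) {c : ℝ} (hc : 0 < c) :
    P.map (stair A n c) = P.map (stair B n c) := by
  have hm : ∀ {D : ℕ → Set Ω}, (∀ i, MeasurableSet (D i)) →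
      IsProbabilityMeasure (P.map (stair D n c)) := fun hD =>
    Measure.isProbabilityMeasure_map (measurable_stair hD n c).aemeasurable
  have := hm hAm
  have := hm hBm
  have key : ∀ {D : ℕ → Set Ω}, Antitone D → (∀ i, MeasurableSet (D i)) → ∀ x : ℝ,
      (P.map (stair D n c)).real (Ioi x) =
        if x < 0 then 1 else if ⌊x / c⌋₊ < n then P.real (D ⌊x / c⌋₊) else 0 := by
    intro D hD hDm x
    rw [map_measureReal_apply (measurable_stair hDm n c) measurableSet_Ioi]
    split_ifs with h1 h2
    · convert! probReal_univ (μ := P)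
      exact eq_univ_of_forall fun ω => h1.trans_le (stair_nonneg D n hc.le ω)
    · congr 1
      ext ω
      simp [stair_gt_iff hD n hc (not_lt.1 h1), h2]
    · convert! measureReal_empty (μ := P)
      ext ω
      simp [stair_gt_iff hD n hc (not_lt.1 h1), h2]
  refine Measure.ext_of_Iic _ _ fun x => ?_
  rw [← measureReal_eq_measureReal_iff, ← compl_Ioi, probReal_compl_eq_one_sub measurableSet_Ioi,
    probReal_compl_eq_one_sub measurableSet_Ioi, key hA hAm, key hB hBm]
  simp [h]

/-! ### Measures from additive set functions; Riemann sums and staircase approximation. -/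

section

/-- A finitely additive nonnegative set function that is small on sets of small `P`-probability
is a measure. -/
theorem exists_measure_of_additive [IsFiniteMeasure P] (m : Set Ω → ℝ)
    (h0 : ∀ A, MeasurableSet A → 0 ≤ m A)
    (hadd : ∀ A B, MeasurableSet A → MeasurableSet B → Disjoint A B → m (A ∪ B) = m A + m B)
    (hcont : ∀ A : ℕ → Set Ω, (∀ n, MeasurableSet (A n)) →
      Tendsto (fun n => P.real (A n)) atTop (𝓝 0) → Tendsto (fun n => m (A n)) atTop (𝓝 0)) :
    ∃ ν : Measure Ω, ∀ A, MeasurableSet A → ν A = ENNReal.ofReal (m A) := by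
  have hempty : m ∅ = 0 := by
    have := hadd ∅ ∅ MeasurableSet.empty MeasurableSet.empty (disjoint_empty ∅)
    rw [union_self] at this
    linarith
  refine ⟨Measure.ofMeasurable (fun A _ => ENNReal.ofReal (m A)) (by simp [hempty]) ?_,
    fun A hA => Measure.ofMeasurable_apply A hA⟩
  intro f hf hdisj
  have hU : MeasurableSet (⋃ i, f i) := MeasurableSet.iUnion hf
  -- The remainders decrease to the empty set, so `hcont` makes `m (R n)` vanish; this turns
  -- additivity into countable additivity.
  let R : ℕ → Set Ω := fun n => (⋃ i, f i) \ ⋃ i < n, f i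
  have hRm : ∀ n, MeasurableSet (R n) := fun n =>
    hU.diff (MeasurableSet.biUnion (to_countable _) fun i _ => hf i)
  have hsum : ∀ n, m (⋃ i < n, f i) = ∑ i ∈ Finset.range n, m (f i) := by
    intro n
    induction n with
    | zero => simp [hempty]
    | succ n ih =>
      rw [Finset.sum_range_succ, ← ih, biUnion_lt_succ]
      refine hadd _ _ (MeasurableSet.biUnion (to_countable _) fun i _ => hf i) (hf n) ?_
      simp only [disjoint_iUnion_left]
      exact fun i hi => hdisj hi.ne
  have hsplit : ∀ n, ∑ i ∈ Finset.range n, m (f i) = m (⋃ i, f i) - m (R n) := by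
    intro n
    have hsub : (⋃ i < n, f i) ⊆ ⋃ i, f i := iUnion₂_subset fun i _ => subset_iUnion f i
    have := hadd (⋃ i < n, f i) (R n)
      (MeasurableSet.biUnion (to_countable _) fun i _ => hf i) (hRm n) disjoint_sdiff_right
    rw [← hsum, eq_sub_iff_add_eq, ← this]
    exact congrArg m (union_sdiff_cancel hsub)
  have hlim : Tendsto (fun n => P.real (R n)) atTop (𝓝 0) := by
    have hanti : Antitone R := fun a b hab =>
      sdiff_subset_sdiff_right (biUnion_mono (fun i hi => lt_of_lt_of_le hi hab) fun _ _ => Subset.rfl)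
    have hinter : ⋂ n, R n = ∅ := by
      refine eq_empty_of_forall_notMem fun ω hω => ?_
      rw [mem_iInter] at hω
      obtain ⟨i, hi⟩ := mem_iUnion.1 (hω 0).1
      exact (hω (i + 1)).2 (mem_biUnion (Nat.lt_succ_self i) hi)
    have := (ENNReal.tendsto_toReal (measure_ne_top P _)).comp
      (tendsto_measure_iInter_atTop (fun n => (hRm n).nullMeasurableSet) hanti
        ⟨0, measure_ne_top _ _⟩)
    rwa [hinter, measure_empty, ENNReal.toReal_zero] at this
  have hs : HasSum (fun i => m (f i)) (m (⋃ i, f i)) := by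
    rw [hasSum_iff_tendsto_nat_of_nonneg fun i => h0 _ (hf i)]
    simp_rw [hsplit]
    simpa using (hcont R hRm hlim).const_sub (m (⋃ i, f i))
  rw [← hs.tsum_eq, ENNReal.ofReal_tsum_of_nonneg (fun i => h0 _ (hf i)) hs.summable]

/-- Riemann sums with mesh `1 / n` of an antitone function on `[0, M]`. -/
theorem integral_le_riemannSum_of_antitone {f : ℝ → ℝ} (hf : Antitone f) (M : ℕ) {n : ℕ}
    (hn : 0 < n) :
    ∫ x in (0 : ℝ)..M, f x ≤ ∑ i ∈ Finset.range (M * n), (1 / n : ℝ) * f (i / n) := by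
  have hn' : (0 : ℝ) < n := Nat.cast_pos.2 hn
  have hg : Antitone fun x : ℝ => f (x / n) := fun x y hxy => hf (by gcongr)
  have h := (hg.antitoneOn (Icc 0 (0 + (M * n : ℕ) : ℝ))).integral_le_sum
  rw [intervalIntegral.integral_comp_div f hn'.ne'] at h
  simp only [zero_add, zero_div, Nat.cast_mul, mul_div_cancel_right₀ _ hn'.ne', smul_eq_mul] at h
  rw [← Finset.mul_sum, one_div, ← div_eq_inv_mul, le_div_iff₀' hn']
  exact h

theorem riemannSum_le_integral_of_antitone {f : ℝ → ℝ} (hf : Antitone f) (h0 : ∀ x, 0 ≤ f x) (M : ℕ)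
    {n : ℕ} (hn : 0 < n) :
    ∑ i ∈ Finset.range (M * n), (1 / n : ℝ) * f (i / n) ≤
      (∫ x in (0 : ℝ)..M, f x) + f 0 * (1 / n) := by
  have hn' : (0 : ℝ) < n := Nat.cast_pos.2 hn
  have hg : Antitone fun x : ℝ => f (x / n) := fun x y hxy => hf (by gcongr)
  have h := (hg.antitoneOn (Icc 0 (0 + (M * n : ℕ) : ℝ))).sum_le_integral
  rw [intervalIntegral.integral_comp_div f hn'.ne'] at h
  simp only [zero_add, zero_div, Nat.cast_mul, mul_div_cancel_right₀ _ hn'.ne', smul_eq_mul] at h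
  -- The integral dominates the right-endpoint sum; passing to left endpoints costs at most `f 0`.
  have e : ∑ i ∈ Finset.range (M * n), f ((i : ℝ) / n) ≤
      ∑ i ∈ Finset.range (M * n), f (((i + 1 : ℕ) : ℝ) / n) + f 0 := by
    have h1 := Finset.sum_range_succ' (fun i : ℕ => f ((i : ℝ) / n)) (M * n)
    have h2 := Finset.sum_range_succ (fun i : ℕ => f ((i : ℝ) / n)) (M * n)
    have h3 := h0 (((M * n : ℕ) : ℝ) / n)
    simp only [Nat.cast_zero, zero_div] at h1
    linarith
  rw [← Finset.mul_sum, one_div, ← div_eq_inv_mul, div_le_iff₀' hn', mul_add, mul_left_comm,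
    mul_inv_cancel₀ hn'.ne', mul_one]
  linarith

theorem stair_le {α : Type*} {Y : α → ℝ} (n k : ℕ) (hn : 0 < n) {ω : α} (hω : 0 ≤ Y ω) :
    stair (fun i => {ω | (i / n : ℝ) < Y ω}) k (1 / n) ω ≤ Y ω + 1 / n := by
  have hn' : (0 : ℝ) < n := Nat.cast_pos.2 hn
  have hanti : Antitone fun i : ℕ => {ω | (i / n : ℝ) < Y ω} := fun i j hij ω hω =>
    lt_of_le_of_lt (show (i / n : ℝ) ≤ j / n by gcongr) hω
  by_contra! h
  rw [stair_gt_iff hanti k (by positivity) (by positivity)] at h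
  have h2 : ((⌊(Y ω + 1 / n) / (1 / n)⌋₊ : ℕ) / n : ℝ) < Y ω := h.2
  have h3 := Nat.lt_floor_add_one ((Y ω + 1 / n) / (1 / n : ℝ))
  rw [div_lt_iff₀ hn'] at h2
  have h4 : (Y ω + 1 / n) / (1 / n : ℝ) = Y ω * n + 1 := by field_simp
  rw [h4] at h2 h3
  linarith

theorem min_le_stair {α : Type*} {Y : α → ℝ} (M n : ℕ) (hn : 0 < n) (ω : α) :
    min (Y ω) M ≤ stair (fun i => {ω | (i / n : ℝ) < Y ω}) (M * n) (1 / n) ω := by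
  have hn' : (0 : ℝ) < n := Nat.cast_pos.2 hn
  have hanti : Antitone fun i : ℕ => {ω | (i / n : ℝ) < Y ω} := fun i j hij ω hω =>
    lt_of_le_of_lt (show (i / n : ℝ) ≤ j / n by gcongr) hω
  by_contra! h
  set x := stair (fun i => {ω | (i / n : ℝ) < Y ω}) (M * n) (1 / n) ω with hx
  have hx0 : 0 ≤ x := stair_nonneg _ _ (by positivity) ω
  have h1 : ¬ x < x := lt_irrefl x
  nth_rw 2 [hx] at h1
  rw [stair_gt_iff hanti _ (by positivity) hx0] at h1
  have hfl : (⌊x / (1 / n : ℝ)⌋₊ : ℝ) ≤ x * n := by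
    refine (Nat.floor_le (by positivity)).trans_eq ?_
    field_simp
  obtain ⟨hY, hM⟩ := lt_min_iff.1 h
  refine h1 ⟨?_, ?_⟩
  · have : x * n < M * n := by gcongr
    exact_mod_cast hfl.trans_lt this
  · exact lt_of_le_of_lt ((div_le_iff₀ hn').2 hfl) hY

/-! ### Coherent risk measures: elements of `𝒳`, Hahn–Banach, behaviour of `g_ρ` at zero. -/

section Risk

variable {𝒳 : Submodule ℝ (Lp ℝ 1 P)} {ρ : 𝒳 → ℝ}

theorem ContainsLinfty.exists_ae_eq [IsFiniteMeasure P] (h𝒳 : ContainsLinfty 𝒳) {f : Ω → ℝ}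
    (hf : MemLp f ⊤ P) : ∃ Y : 𝒳, (Y : Lp ℝ 1 P) =ᵐ[P] f := by
  have h1 : MemLp f 1 P := hf.mono_exponent le_top
  exact ⟨⟨h1.toLp f, h𝒳 _ ((memLp_congr_ae h1.coeFn_toLp).2 hf)⟩, h1.coeFn_toLp⟩

theorem ContainsLinfty.exists_ae_eq_indicator [IsFiniteMeasure P] (h𝒳 : ContainsLinfty 𝒳)
    {A : Set Ω} (hA : MeasurableSet A) :
    ∃ Y : 𝒳, (Y : Lp ℝ 1 P) =ᵐ[P] A.indicator fun _ => (1 : ℝ) :=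
  h𝒳.exists_ae_eq ((memLp_const 1).indicator hA)

theorem ContainsLinfty.exists_ae_eq_tail [IsFiniteMeasure P] (h𝒳 : ContainsLinfty 𝒳)
    (hlat : IsStoneanLattice 𝒳) (X : 𝒳) (k : ℝ) :
    ∃ T : 𝒳, (T : Lp ℝ 1 P) =ᵐ[P] fun ω => max ((X : Lp ℝ 1 P) ω - k) 0 := by
  obtain ⟨C, hC⟩ := h𝒳.exists_ae_eq (memLp_const (μ := P) (p := ⊤) k)
  refine ⟨⟨_, (hlat _ (X - C).2 _ (0 : 𝒳).2).2⟩, ?_⟩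
  filter_upwards [hC, Lp.coeFn_sup (((X - C : 𝒳) : Lp ℝ 1 P)) ((0 : 𝒳) : Lp ℝ 1 P),
    Lp.coeFn_sub (X : Lp ℝ 1 P) (C : Lp ℝ 1 P), Lp.coeFn_zero ℝ 1 P] with ω h1 h2 h3 h4
  rw [h2, Pi.sup_apply, Submodule.coe_sub, h3, Submodule.coe_zero, h4, Pi.sub_apply, h1]
  rfl

theorem coe_add_ae (X Y : 𝒳) :
    ((X + Y : 𝒳) : Lp ℝ 1 P) =ᵐ[P] fun ω => (X : Lp ℝ 1 P) ω + (Y : Lp ℝ 1 P) ω :=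
  Lp.coeFn_add _ _

theorem coe_neg_ae (X : 𝒳) : ((-X : 𝒳) : Lp ℝ 1 P) =ᵐ[P] fun ω => -(X : Lp ℝ 1 P) ω :=
  Lp.coeFn_neg _

theorem coe_smul_ae (c : ℝ) (X : 𝒳) :
    ((c • X : 𝒳) : Lp ℝ 1 P) =ᵐ[P] fun ω => c * (X : Lp ℝ 1 P) ω :=
  Lp.coeFn_smul _ _

theorem coe_sum_ae (s : Finset ℕ) (X : ℕ → 𝒳) :
    ((∑ i ∈ s, X i : 𝒳) : Lp ℝ 1 P) =ᵐ[P] fun ω => ∑ i ∈ s, (X i : Lp ℝ 1 P) ω := by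
  classical
  induction s using Finset.induction_on with
  | empty => exact Lp.coeFn_zero ℝ 1 P
  | insert a s ha ih =>
    rw [Finset.sum_insert ha]
    filter_upwards [ih, coe_add_ae (X a) (∑ i ∈ s, X i)] with ω h1 h2
    rw [h2, h1, Finset.sum_insert ha]

theorem IsCoherent.map_zero (hcoh : IsCoherent 𝒳 ρ) : ρ 0 = 0 := by
  simpa using hcoh.pos_homogeneous 0 0 le_rfl

theorem IsCoherent.neg_mono (hcoh : IsCoherent 𝒳 ρ) {X Y : 𝒳}
    (h : (X : Lp ℝ 1 P) ≤ᵐ[P] (Y : Lp ℝ 1 P)) : ρ (-X) ≤ ρ (-Y) := by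
  refine hcoh.antitone (-Y) (-X) ((Lp.coeFn_le _ _).1 ?_)
  filter_upwards [h, coe_neg_ae X, coe_neg_ae Y] with ω h1 h2 h3
  rw [h2, h3]
  exact neg_le_neg h1

theorem IsCoherent.neg_add_const (hcoh : IsCoherent 𝒳 ρ) {X Y : 𝒳} {m : ℝ}
    (h : (Y : Lp ℝ 1 P) =ᵐ[P] fun ω => (X : Lp ℝ 1 P) ω + m) : ρ (-Y) = ρ (-X) + m := by
  rw [hcoh.cash_invariant (-X) (-Y) (-m), sub_neg_eq_add]
  filter_upwards [h, coe_neg_ae X, coe_neg_ae Y] with ω h1 h2 h3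
  rw [h2, h3, h1, neg_add]

/-- Hahn–Banach for the sublinear map `Y ↦ ρ(-Y)`, extending `c • X ↦ -c ρ X` from the line through
`X`. Domination there is homogeneity for `c ≤ 0` and follows from `0 ≤ ρ X + ρ(-X)` for `c ≥ 0`. -/
theorem IsCoherent.exists_dominated_linear (hcoh : IsCoherent 𝒳 ρ) (X : 𝒳) :
    ∃ ℓ : 𝒳 →ₗ[ℝ] ℝ, ℓ X = -ρ X ∧ ∀ Y, ℓ Y ≤ ρ (-Y) := by
  have hX : -ρ X ≤ ρ (-X) := by
    have := hcoh.subadditive X (-X)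
    rw [add_neg_cancel, hcoh.map_zero] at this
    linarith
  have H : ∀ c : ℝ, c • X = 0 → (RingHom.id ℝ) c • (-ρ X) = 0 := by
    intro c hc
    rcases smul_eq_zero.1 hc with h | h
    · simp [h]
    · simp [h, hcoh.map_zero]
  obtain ⟨ℓ, h1, h2⟩ := exists_extension_of_le_sublinear
    (LinearPMap.mkSpanSingleton' X (-ρ X) H) (fun Y => ρ (-Y))
    (fun c hc Y => by rw [← smul_neg, hcoh.pos_homogeneous _ _ hc.le])
    (fun Y Z => by rw [neg_add]; exact hcoh.subadditive _ _) (by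
      rintro ⟨Y, hY⟩
      obtain ⟨c, rfl⟩ := Submodule.mem_span_singleton.1 hY
      rw [LinearPMap.mkSpanSingleton'_apply]
      simp only [RingHom.id_apply, smul_eq_mul]
      rcases le_total 0 c with hc | hc
      · rw [← smul_neg, hcoh.pos_homogeneous _ _ hc]
        exact mul_le_mul_of_nonneg_left hX hc
      · rw [← neg_smul, hcoh.pos_homogeneous _ _ (neg_nonneg.2 hc)]
        linarith)
  refine ⟨ℓ, ?_, h2⟩
  have h3 := LinearPMap.mkSpanSingleton'_apply X (-ρ X) H 1
    (Submodule.smul_mem _ _ (Submodule.mem_span_singleton_self X))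
  rw [← h1] at h3
  simpa using h3

theorem isBernoulliVar_of_ae_eq_indicator [IsFiniteMeasure P] {A : Set Ω} (hA : MeasurableSet A)
    {Y : Lp ℝ 1 P} (hY : Y =ᵐ[P] A.indicator fun _ => (1 : ℝ)) :
    IsBernoulliVar Y (P.real A) := by
  classical
  refine ⟨?_, ?_⟩
  · filter_upwards [hY] with ω h
    rw [h, indicator_apply]
    split_ifs <;> simp
  · rw [integral_congr_ae hY]
    exact integral_indicator_one hA

theorem assocDistortion_real_eq [IsProbabilityMeasure P] (hlaw : IsLawInvariant 𝒳 ρ) {A : Set Ω}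
    (hA : MeasurableSet A) {Y : 𝒳} (hY : (Y : Lp ℝ 1 P) =ᵐ[P] A.indicator fun _ => (1 : ℝ)) :
    assocDistortion 𝒳 ρ (P.real A) = ρ (-Y) :=
  assocDistortion_eq hlaw Y (isBernoulliVar_of_ae_eq_indicator hA hY)

theorem assocDistortion_zero [IsProbabilityMeasure P] (hcoh : IsCoherent 𝒳 ρ)
    (hlaw : IsLawInvariant 𝒳 ρ) : assocDistortion 𝒳 ρ 0 = 0 := by
  have h := assocDistortion_real_eq (P := P) hlaw (A := ∅) MeasurableSet.empty (Y := 0) (by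
    rw [indicator_empty]
    exact Lp.coeFn_zero ℝ 1 P)
  simpa [hcoh.map_zero] using h

/-- Including the point `0` in the filter allows sets of probability zero and equal arguments in
moduli of continuity. -/
theorem tendsto_assocDistortion_zero [IsProbabilityMeasure P] (hcoh : IsCoherent 𝒳 ρ)
    (hlaw : IsLawInvariant 𝒳 ρ) (hb : Tendsto (assocDistortion 𝒳 ρ) (𝓝[>] 0) (𝓝 0)) :
    Tendsto (assocDistortion 𝒳 ρ) (𝓝[≥] 0) (𝓝 0) := by
  have h0 : Tendsto (assocDistortion 𝒳 ρ) (pure 0) (𝓝 0) := by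
    rw [tendsto_pure_left, assocDistortion_zero hcoh hlaw]
    exact fun s hs => mem_of_mem_nhds hs
  have := h0.sup hb
  rwa [← nhdsWithin_singleton, ← nhdsWithin_union, singleton_union, Ioi_insert] at this

end Risk

end

/-! ### Domination by `ρ` and the distortion of a supporting functional. -/

section

/-- The distortion function `g` is dominated by `ρ`: the Choquet integrals of the nonnegative
elements of `𝒳` with respect to `g ∘ P`, cut off at all levels, are bounded by `ρ (-Y)`. -/
def IsDominated (P : Measure Ω) (𝒳 : Submodule ℝ (Lp ℝ 1 P)) (ρ : 𝒳 → ℝ)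
    (g : unitInterval → ℝ) : Prop :=
  ∀ Y : 𝒳, 0 ≤ᵐ[P] (Y : Lp ℝ 1 P) → ∀ M : ℕ,
    ∫ x in (0 : ℝ)..M, ext01 g (P.real {ω | x < (Y : Lp ℝ 1 P) ω}) ≤ ρ (-Y)

theorem IsConcaveDistortion.ext01_mono {g : unitInterval → ℝ} (hg : IsConcaveDistortion g) :
    Monotone (ext01 g) :=
  hg.monotone.IccExtend _

theorem IsConcaveDistortion.ext01_nonneg {g : unitInterval → ℝ} (hg : IsConcaveDistortion g)
    (x : ℝ) : 0 ≤ ext01 g x := by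
  rw [← hg.map_zero]
  exact hg.monotone unitInterval.nonneg'

theorem IsConcaveDistortion.ext01_le_one {g : unitInterval → ℝ} (hg : IsConcaveDistortion g)
    (x : ℝ) : ext01 g x ≤ 1 := by
  rw [← hg.map_one]
  exact hg.monotone unitInterval.le_one'

theorem ext01_zero (g : unitInterval → ℝ) : ext01 g 0 = g 0 := IccExtend_left _ g

theorem ext01_one (g : unitInterval → ℝ) : ext01 g 1 = g 1 := IccExtend_right _ g

theorem IsConcaveDistortion.antitone_ext01_meas [IsFiniteMeasure P] {g : unitInterval → ℝ}
    (hg : IsConcaveDistortion g) (Y : Ω → ℝ) :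
    Antitone fun x : ℝ => ext01 g (P.real {ω | x < Y ω}) := fun _ _ hxy =>
  hg.ext01_mono (measureReal_mono fun _ hω => lt_of_le_of_lt hxy hω)

variable {𝒳 : Submodule ℝ (Lp ℝ 1 P)} {ρ : 𝒳 → ℝ}

theorem le_of_forall_nat_inv {a b c : ℝ} (h : ∀ n : ℕ, 0 < n → a ≤ b + c * (1 / n)) :
    a ≤ b := by
  have hlim : Tendsto (fun n : ℕ => b + c * (1 / ((n + 1 : ℕ) : ℝ))) atTop (𝓝 (b + c * 0)) :=
    (((tendsto_one_div_atTop_nhds_zero_nat (𝕜 := ℝ)).comp (tendsto_add_atTop_nat 1)).const_mul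
      c).const_add b
  rw [mul_zero, add_zero] at hlim
  exact ge_of_tendsto' hlim fun n => h (n + 1) n.succ_pos

/-- A linear functional dominated by `ρ (-·)` is given on indicators by a probability measure with
density, and a distortion function bounds it from above and is dominated by `ρ`. -/
theorem exists_isDominated_of_linear [IsProbabilityMeasure P] (hP : IsAtomless P)
    (h𝒳 : ContainsLinfty 𝒳) (hcoh : IsCoherent 𝒳 ρ)
    (hlaw : IsLawInvariant 𝒳 ρ) (hb : Tendsto (assocDistortion 𝒳 ρ) (𝓝[>] 0) (𝓝 0))
    {ℓ : 𝒳 →ₗ[ℝ] ℝ} (hℓ : ∀ Y, ℓ Y ≤ ρ (-Y)) :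
    ∃ g : unitInterval → ℝ, IsConcaveDistortion g ∧ IsDominated P 𝒳 ρ g ∧
      ∀ (Y T : 𝒳) (M : ℕ), 0 ≤ᵐ[P] (Y : Lp ℝ 1 P) →
        ((T : Lp ℝ 1 P) =ᵐ[P] fun ω => max ((Y : Lp ℝ 1 P) ω - M) 0) →
        ℓ Y ≤ (∫ x in (0 : ℝ)..M, ext01 g (P.real {ω | x < (Y : Lp ℝ 1 P) ω})) + ρ (-T) := by
  have hℓmono : ∀ Y Z : 𝒳, (Y : Lp ℝ 1 P) ≤ᵐ[P] (Z : Lp ℝ 1 P) → ℓ Y ≤ ℓ Z := by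
    intro Y Z h
    have h1 := hℓ (Y - Z)
    have h2 : ρ (-(Y - Z)) ≤ ρ (-0) := hcoh.neg_mono (by
      filter_upwards [h, Lp.coeFn_sub (Y : Lp ℝ 1 P) (Z : Lp ℝ 1 P), Lp.coeFn_zero ℝ 1 P]
        with ω h1 h2 h3
      rw [Submodule.coe_sub, h2, Submodule.coe_zero, h3, Pi.sub_apply, Pi.zero_apply]
      exact sub_nonpos.2 h1)
    rw [neg_zero, hcoh.map_zero] at h2
    rw [map_sub] at h1
    linarith
  have hℓae : ∀ Y Z : 𝒳, (Y : Lp ℝ 1 P) =ᵐ[P] (Z : Lp ℝ 1 P) → ℓ Y = ℓ Z := fun Y Z h =>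
    le_antisymm (hℓmono _ _ h.le) (hℓmono _ _ h.symm.le)
  have hI : ∀ A : Set Ω, ∃ Y : 𝒳, MeasurableSet A →
      (Y : Lp ℝ 1 P) =ᵐ[P] A.indicator fun _ => (1 : ℝ) := fun A => by
    by_cases hA : MeasurableSet A
    · exact (h𝒳.exists_ae_eq_indicator hA).imp fun Y hY _ => hY
    · exact ⟨0, fun h => absurd h hA⟩
  choose I hI using hI
  have hI0 : ∀ A, MeasurableSet A → 0 ≤ ℓ (I A) := fun A hA => by
    rw [← map_zero ℓ]
    refine hℓmono _ _ ?_
    filter_upwards [hI A hA, Lp.coeFn_zero ℝ 1 P] with ω h1 h2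
    rw [h1, Submodule.coe_zero, h2]
    exact indicator_nonneg (fun _ _ => zero_le_one) ω
  have hbound : ∀ A, MeasurableSet A → ℓ (I A) ≤ assocDistortion 𝒳 ρ (P.real A) := fun A hA => by
    rw [assocDistortion_real_eq hlaw hA (hI A hA)]
    exact hℓ _
  obtain ⟨ν, hν⟩ := exists_measure_of_additive (P := P) (fun A => ℓ (I A)) hI0
    (by
      intro A B hA hB hd
      rw [← map_add]
      refine hℓae _ _ ?_
      filter_upwards [hI _ (hA.union hB), hI A hA, hI B hB, coe_add_ae (I A) (I B)]
        with ω h1 h2 h3 h4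
      rw [h1, h4, h2, h3, indicator_union_of_disjoint hd])
    (fun A hA hlim => squeeze_zero (fun n => hI0 _ (hA n)) (fun n => hbound _ (hA n))
      ((tendsto_assocDistortion_zero hcoh hlaw hb).comp
        (tendsto_nhdsWithin_iff.2 ⟨hlim, Eventually.of_forall fun n => measureReal_nonneg⟩)))
  have hνr : ∀ A, MeasurableSet A → ν.real A = ℓ (I A) := fun A hA => by
    rw [measureReal_def, hν A hA, ENNReal.toReal_ofReal (hI0 A hA)]
  -- Cash invariance at the constants `1` and `-1` gives the two inequalities.
  have hone : ℓ (I univ) = 1 := by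
    have e : ∀ m : ℝ, ρ (-(m • I univ)) = m := fun m => by
      rw [hcoh.neg_add_const (X := 0) (m := m), neg_zero, hcoh.map_zero, zero_add]
      filter_upwards [coe_smul_ae m (I univ), hI univ MeasurableSet.univ, Lp.coeFn_zero ℝ 1 P]
        with ω h1 h2 h3
      rw [h1, h2, Submodule.coe_zero, h3]
      simp
    have h1 := hℓ ((1 : ℝ) • I univ)
    have h2 := hℓ ((-1 : ℝ) • I univ)
    rw [e, map_smul, smul_eq_mul] at h1 h2
    linarith
  have hνp : IsProbabilityMeasure ν := ⟨by rw [hν _ MeasurableSet.univ, hone, ENNReal.ofReal_one]⟩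
  have hac : ν ≪ P := Measure.AbsolutelyContinuous.mk fun A hA h0 => by
    have := hbound A hA
    rw [measureReal_def, h0, ENNReal.toReal_zero, assocDistortion_zero hcoh hlaw] at this
    rw [hν A hA, ENNReal.ofReal_eq_zero]
    exact this
  have hdens := Measure.withDensity_rnDeriv_eq ν P hac
  have hZ := Measure.measurable_rnDeriv ν P
  have : IsProbabilityMeasure (P.withDensity (ν.rnDeriv P)) := by rwa [hdens]
  obtain ⟨g, hg, hle, heq⟩ := exists_distortion_withDensity hP hZ
  rw [hdens] at hle heq
  have hstair : ∀ (A : ℕ → Set Ω), (∀ i, MeasurableSet (A i)) → ∀ (k : ℕ) (c : ℝ),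
      ((∑ i ∈ Finset.range k, c • I (A i) : 𝒳) : Lp ℝ 1 P) =ᵐ[P] stair A k c := by
    intro A hA k c
    have hall : ∀ᵐ ω ∂P, ∀ i, ((c • I (A i) : 𝒳) : Lp ℝ 1 P) ω = (A i).indicator (fun _ => c) ω :=
      ae_all_iff.2 fun i => by
        filter_upwards [hI _ (hA i), coe_smul_ae c (I (A i))] with ω h1 h2
        rw [h2, h1]
        by_cases hω : ω ∈ A i <;> simp [hω]
    filter_upwards [coe_sum_ae (Finset.range k) fun i => c • I (A i), hall] with ω h1 h2
    rw [h1]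
    exact Finset.sum_congr rfl fun i _ => h2 i
  have hℓstair : ∀ (A : ℕ → Set Ω), (∀ i, MeasurableSet (A i)) → ∀ (k : ℕ) (c : ℝ),
      ℓ (∑ i ∈ Finset.range k, c • I (A i)) = ∑ i ∈ Finset.range k, c * ν.real (A i) := by
    intro A hA k c
    rw [map_sum]
    exact Finset.sum_congr rfl fun i _ => by rw [map_smul, smul_eq_mul, hνr _ (hA i)]
  have hlevm : ∀ (Y : 𝒳) (x : ℝ), MeasurableSet {ω | x < (Y : Lp ℝ 1 P) ω} := fun Y x =>
    measurableSet_lt measurable_const (Lp.stronglyMeasurable _).measurable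
  refine ⟨g, hg, ?_, ?_⟩
  · intro Y hY M
    refine le_of_forall_nat_inv (c := 1) fun n hn => ?_
    have hn' : (0 : ℝ) < n := Nat.cast_pos.2 hn
    set A : ℕ → Set Ω := fun i => {ω | (i / n : ℝ) < (Y : Lp ℝ 1 P) ω} with hA
    have hAm : ∀ i, MeasurableSet (A i) := fun i => hlevm Y _
    have hAanti : Antitone A := fun i j hij ω hω =>
      lt_of_le_of_lt (show (i / n : ℝ) ≤ j / n by gcongr) hω
    -- Rearrangement: the `B i` have the probabilities of the level sets of `Y`, but on them `ν`
    -- equals `g ∘ P` exactly.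
    obtain ⟨B, hBanti, hB⟩ := exists_antitone_isUpperLevel hP hZ
      (fun i j hij => measureReal_mono (μ := P) (hAanti hij)) (fun i => measureReal_nonneg)
      measureReal_le_one
    have hBm : ∀ i, MeasurableSet (B i) := fun i => (hB i).1.1
    set W := ∑ i ∈ Finset.range (M * n), (1 / n : ℝ) • I (A i)
    set W' := ∑ i ∈ Finset.range (M * n), (1 / n : ℝ) • I (B i)
    have hWW' : ρ (-W) = ρ (-W') := by
      have hneg : ∀ (D : ℕ → Set Ω) (V : 𝒳), (∀ i, MeasurableSet (D i)) →
          ((V : Lp ℝ 1 P) =ᵐ[P] stair D (M * n) (1 / n)) →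
          P.map ((-V : 𝒳) : Lp ℝ 1 P) = (P.map (stair D (M * n) (1 / n))).map (fun x => -x) := by
        intro D V hD hV
        rw [Measure.map_map measurable_neg (measurable_stair hD _ _)]
        refine Measure.map_congr ?_
        filter_upwards [hV, coe_neg_ae V] with ω h1 h2
        rw [h2, h1, Function.comp_apply]
      refine hlaw _ _ ?_
      rw [hneg A W hAm (hstair A hAm _ _), hneg B W' hBm (hstair B hBm _ _),
        map_stair_eq hAanti hBanti hAm hBm (fun i => (hB i).2.symm) _ (by positivity)]
    have hWY : ρ (-W) ≤ ρ (-Y) + 1 * (1 / n) := by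
      obtain ⟨V, hV⟩ := h𝒳.exists_ae_eq (memLp_const (μ := P) (p := ⊤) (1 / n : ℝ))
      have hYV : ((Y + V : 𝒳) : Lp ℝ 1 P) =ᵐ[P] fun ω => (Y : Lp ℝ 1 P) ω + 1 / n := by
        filter_upwards [hV, coe_add_ae Y V] with ω h1 h2
        rw [h2, h1]
      rw [one_mul, ← hcoh.neg_add_const hYV]
      refine hcoh.neg_mono ?_
      filter_upwards [hYV, hstair A hAm (M * n) (1 / n), hY] with ω h1 h2 h3
      rw [h1, h2]
      exact stair_le n _ hn h3
    calc ∫ x in (0 : ℝ)..M, ext01 g (P.real {ω | x < (Y : Lp ℝ 1 P) ω})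
        ≤ ∑ i ∈ Finset.range (M * n), (1 / n : ℝ) * ext01 g (P.real (A i)) :=
          integral_le_riemannSum_of_antitone (hg.antitone_ext01_meas _) M hn
      _ = ∑ i ∈ Finset.range (M * n), (1 / n : ℝ) * ν.real (B i) :=
          Finset.sum_congr rfl fun i _ => by rw [heq _ (hB i).1, (hB i).2]
      _ = ℓ W' := (hℓstair B hBm _ _).symm
      _ ≤ ρ (-W') := hℓ _
      _ ≤ ρ (-Y) + 1 * (1 / n) := hWW' ▸ hWY
  · intro Y T M hY hT
    refine le_of_forall_nat_inv (c := 1) fun n hn => ?_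
    set A : ℕ → Set Ω := fun i => {ω | (i / n : ℝ) < (Y : Lp ℝ 1 P) ω} with hA
    have hAm : ∀ i, MeasurableSet (A i) := fun i => hlevm Y _
    set W := ∑ i ∈ Finset.range (M * n), (1 / n : ℝ) • I (A i)
    have h1 : ℓ Y ≤ ℓ (W + T) := by
      refine hℓmono _ _ ?_
      filter_upwards [coe_add_ae W T, hstair A hAm (M * n) (1 / n), hT] with ω h1 h2 h3
      rw [h1, h2, h3]
      have := min_le_stair (Y := (Y : Lp ℝ 1 P)) M n hn ω
      rcases le_total ((Y : Lp ℝ 1 P) ω) M with h | h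
      · rw [min_eq_left h] at this
        linarith [le_max_right ((Y : Lp ℝ 1 P) ω - M) 0]
      · rw [min_eq_right h] at this
        linarith [le_max_left ((Y : Lp ℝ 1 P) ω - M) 0]
    have h2 : ℓ W ≤ ∑ i ∈ Finset.range (M * n), (1 / n : ℝ) * ext01 g (P.real (A i)) := by
      rw [hℓstair A hAm]
      gcongr with i
      exact hle _ (hAm i)
    have h3 := riemannSum_le_integral_of_antitone (hg.antitone_ext01_meas (P := P) (Y : Lp ℝ 1 P))
      (fun x => hg.ext01_nonneg _) M hn
    have h4 : ext01 g (P.real {ω | (0 : ℝ) < (Y : Lp ℝ 1 P) ω}) * (1 / n : ℝ) ≤ 1 * (1 / n) := by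
      gcongr
      exact hg.ext01_le_one _
    have h5 := hℓ T
    rw [map_add] at h1
    linarith

end

/-! ### Regularity of concave distortions and compactness of the dominated ones. -/

section

namespace IsConcaveDistortion

variable {g : unitInterval → ℝ}

theorem mul_le_ext01 (hg : IsConcaveDistortion g) {c t : ℝ} (hc : c ∈ Icc (0 : ℝ) 1)
    (ht : t ∈ Icc (0 : ℝ) 1) :
    c * ext01 g t ≤ ext01 g (c * t) := by
  have := hg.concave.2 (left_mem_Icc.2 zero_le_one) ht (sub_nonneg.2 hc.2) hc.1 (by ring)
  simpa [ext01_zero, hg.map_zero] using this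

theorem le_ext01 (hg : IsConcaveDistortion g) {t : ℝ} (ht : t ∈ Icc (0 : ℝ) 1) : t ≤ ext01 g t := by
  simpa [ext01_one, hg.map_one] using hg.mul_le_ext01 ht (right_mem_Icc.2 zero_le_one)

/-- Concavity with `g 0 = 0` makes `g r / r` nonincreasing; compare both `s` and `t` with `s + t`.
-/
theorem ext01_add_le (hg : IsConcaveDistortion g) {s t : ℝ} (hs : 0 ≤ s) (ht : 0 ≤ t)
    (h : s + t ≤ 1) :
    ext01 g (s + t) ≤ ext01 g s + ext01 g t := by
  rcases (add_nonneg hs ht).eq_or_lt with h0 | h0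
  · have h1 : s = 0 := by linarith
    rw [h1, zero_add]
    linarith [hg.ext01_nonneg 0]
  · have key : ∀ r, 0 ≤ r → r ≤ s + t → r / (s + t) * ext01 g (s + t) ≤ ext01 g r := by
      intro r hr hr'
      have := hg.mul_le_ext01 ⟨div_nonneg hr h0.le, (div_le_one h0).2 hr'⟩
        (show s + t ∈ Icc (0 : ℝ) 1 from ⟨h0.le, h⟩)
      rwa [div_mul_cancel₀ _ h0.ne'] at this
    have h1 := key s hs (by linarith)
    have h2 := key t ht (by linarith)
    have h3 : s / (s + t) * ext01 g (s + t) + t / (s + t) * ext01 g (s + t) = ext01 g (s + t) := by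
      field_simp
    linarith

theorem dist_le_ext01 (hg : IsConcaveDistortion g) (s t : unitInterval) : dist (g s) (g t) ≤ ext01 g (dist s t) := by
  wlog hst : s ≤ t generalizing s t
  · rw [dist_comm (g s), dist_comm s]
    exact this t s (le_of_not_ge hst)
  have hst' : (s : ℝ) ≤ t := hst
  have h := hg.ext01_add_le s.2.1 (sub_nonneg.2 hst') (by linarith [t.2.2])
  rw [add_sub_cancel, ext01_of_mem t.2, ext01_of_mem s.2] at h
  rw [dist_comm, Real.dist_eq, abs_of_nonneg (sub_nonneg.2 (hg.monotone hst)), dist_comm,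
    Subtype.dist_eq, Real.dist_eq, abs_of_nonneg (sub_nonneg.2 hst')]
  simp only [Subtype.coe_eta] at h
  linarith

theorem differentiableWithinAt_Ioi (hg : IsConcaveDistortion g) {t : ℝ} (ht : t ∈ Ioo (0 : ℝ) 1) :
    DifferentiableWithinAt ℝ (ext01 g) (Ioi t) t := by
  have h := hg.concave.neg.differentiableWithinAt_Ioi_of_mem_interior (x := t)
    (by rwa [interior_Icc])
  simpa using h.neg

/-- For `y > t`, `g t ≥ (t / y) g y` says that the slope from `t` to `y` is at most the slope `g t /
t` of the chord from the origin. -/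
theorem derivWithin_Ioi_le (hg : IsConcaveDistortion g) {t : ℝ} (ht : t ∈ Ioo (0 : ℝ) 1) :
    derivWithin (ext01 g) (Ioi t) t ≤ ext01 g t / t := by
  have h := (hg.differentiableWithinAt_Ioi ht).hasDerivWithinAt
  rw [hasDerivWithinAt_iff_tendsto_slope' self_notMem_Ioi] at h
  refine le_of_tendsto h ?_
  filter_upwards [Ioc_mem_nhdsGT ht.2] with y hy
  have hy0 : 0 < y := ht.1.trans hy.1
  have := hg.mul_le_ext01 (c := t / y) (t := y)
    ⟨div_nonneg ht.1.le hy0.le, (div_le_one hy0).2 hy.1.le⟩ ⟨hy0.le, hy.2⟩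
  rw [div_mul_cancel₀ _ hy0.ne', div_mul_eq_mul_div, div_le_iff₀ hy0] at this
  rw [slope_def_field, div_le_div_iff₀ (sub_pos.2 hy.1) ht.1]
  nlinarith

end IsConcaveDistortion

theorem continuous_ext01 (g : C(unitInterval, ℝ)) : Continuous (ext01 g) :=
  g.continuous.comp continuous_projIcc

theorem continuous_ext01_apply (x : ℝ) : Continuous fun g : C(unitInterval, ℝ) => ext01 g x :=
  continuous_eval_const _

theorem isClosed_setOf_isConcaveDistortion :
    IsClosed {g : C(unitInterval, ℝ) | IsConcaveDistortion g} := by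
  have : {g : C(unitInterval, ℝ) | IsConcaveDistortion g} =
      {g : C(unitInterval, ℝ) | Monotone g} ∩ ({g | g 0 = 0} ∩ ({g | g 1 = 1} ∩
        {g : C(unitInterval, ℝ) | ConcaveOn ℝ (Icc 0 1) (ext01 g)})) := by
    ext g
    exact ⟨fun h => ⟨h.1, h.2, h.3, h.4⟩, fun h => ⟨h.1, h.2.1, h.2.2.1, h.2.2.2⟩⟩
  rw [this]
  refine IsClosed.inter ?_ (IsClosed.inter ?_ (IsClosed.inter ?_ ?_))
  · simp only [Monotone, ofPred_forall]
    exact isClosed_iInter fun a => isClosed_iInter fun b => isClosed_iInter fun _ =>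
      isClosed_le (continuous_eval_const _) (continuous_eval_const _)
  · exact isClosed_eq (continuous_eval_const _) continuous_const
  · exact isClosed_eq (continuous_eval_const _) continuous_const
  · simp only [ConcaveOn, convex_Icc, true_and, ofPred_forall]
    exact isClosed_iInter fun s => isClosed_iInter fun _ => isClosed_iInter fun t =>
      isClosed_iInter fun _ => isClosed_iInter fun a => isClosed_iInter fun b =>
      isClosed_iInter fun _ => isClosed_iInter fun _ => isClosed_iInter fun _ =>
      isClosed_le (((continuous_ext01_apply s).const_mul a).add
        ((continuous_ext01_apply t).const_mul b)) (continuous_ext01_apply _)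

/-- Integrals of `a + c * g (F x)` over a set depend continuously on `g` as long as they have an
integrable majorant. -/
theorem continuousOn_setIntegral_ext01 {F b : ℝ → ℝ} (hF : Measurable F) (a c : ℝ) {s : Set ℝ}
    (hs : MeasurableSet s) (hb : IntegrableOn b s) {S : Set C(unitInterval, ℝ)}
    (h : ∀ g ∈ S, ∀ x ∈ s, |a + c * ext01 g (F x)| ≤ b x) :
    ContinuousOn (fun g : C(unitInterval, ℝ) => ∫ x in s, (a + c * ext01 g (F x))) S :=
  continuousOn_of_dominated
    (fun g _ => ((((continuous_ext01 g).measurable.comp hF).const_mul c).const_add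
      a).aestronglyMeasurable)
    (fun g hg => (ae_restrict_iff' hs).2 (Eventually.of_forall (h g hg))) hb
    (Eventually.of_forall fun x =>
      (((continuous_ext01_apply (F x)).const_mul c).const_add a).continuousOn)

variable {𝒳 : Submodule ℝ (Lp ℝ 1 P)} {ρ : 𝒳 → ℝ}

theorem IsAtomless.exists_real_eq [IsProbabilityMeasure P] (hP : IsAtomless P) {t : ℝ}
    (ht : t ∈ Icc (0 : ℝ) 1) : ∃ A, MeasurableSet A ∧ P.real A = t := by
  obtain ⟨A, hA, -, -, h⟩ := hP.exists_between_real_eq (L := ∅) (U := univ) MeasurableSet.empty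
    MeasurableSet.univ (empty_subset _) (s := t) (by simpa using ht.1) (by simpa using ht.2)
  exact ⟨A, hA, h⟩

/-- Test domination on the indicator of a set of probability `t` with `M = 1`: the integrand is
constantly `g t` on `(0, 1)`. -/
theorem IsDominated.ext01_le_assocDistortion [IsProbabilityMeasure P] (hP : IsAtomless P)
    (h𝒳 : ContainsLinfty 𝒳) (hlaw : IsLawInvariant 𝒳 ρ) {g : unitInterval → ℝ}
    (hd : IsDominated P 𝒳 ρ g) {t : ℝ} (ht : t ∈ Icc (0 : ℝ) 1) :
    ext01 g t ≤ assocDistortion 𝒳 ρ t := by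
  obtain ⟨A, hA, rfl⟩ := hP.exists_real_eq ht
  obtain ⟨Y, hY⟩ := h𝒳.exists_ae_eq_indicator hA
  rw [assocDistortion_real_eq hlaw hA hY]
  have h := hd Y (by
    filter_upwards [hY] with ω h
    rw [h]
    exact indicator_nonneg (fun _ _ => zero_le_one) ω) 1
  refine le_trans (le_of_eq ?_) h
  rw [intervalIntegral.integral_of_le (by simp), integral_Ioc_eq_integral_Ioo]
  have : ∀ x ∈ Ioo (0 : ℝ) ((1 : ℕ) : ℝ),
      ext01 g (P.real {ω | x < (Y : Lp ℝ 1 P) ω}) = ext01 g (P.real A) := by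
    intro x hx
    rw [Nat.cast_one] at hx
    congr 1
    refine measureReal_congr ?_
    filter_upwards [hY] with ω h
    refine propext (show x < (Y : Lp ℝ 1 P) ω ↔ ω ∈ A from ?_)
    rw [h]
    by_cases hω : ω ∈ A
    · simp [hω, hx.2]
    · simp [hω, hx.1.le]
  rw [setIntegral_congr_fun measurableSet_Ioo this]
  simp

/-- The continuous concave distortion functions dominated by `ρ`. -/
def dominatedDistortions (P : Measure Ω) (𝒳 : Submodule ℝ (Lp ℝ 1 P)) (ρ : 𝒳 → ℝ) :
    Set C(unitInterval, ℝ) :=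
  {g | IsConcaveDistortion g ∧ IsDominated P 𝒳 ρ g}

theorem tendsto_assocDistortion_abs [IsProbabilityMeasure P] (hcoh : IsCoherent 𝒳 ρ)
    (hlaw : IsLawInvariant 𝒳 ρ) (hb : Tendsto (assocDistortion 𝒳 ρ) (𝓝[>] 0) (𝓝 0)) :
    Tendsto (fun x => assocDistortion 𝒳 ρ |x|) (𝓝 0) (𝓝 0) := by
  refine (tendsto_assocDistortion_zero hcoh hlaw hb).comp
    (tendsto_nhdsWithin_iff.2 ⟨?_, Eventually.of_forall fun x => abs_nonneg x⟩)
  simpa using (continuous_abs : Continuous fun x : ℝ => |x|).tendsto 0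

theorem IsConcaveDistortion.dist_le_assocDistortion [IsProbabilityMeasure P] (hP : IsAtomless P)
    (h𝒳 : ContainsLinfty 𝒳) (hlaw : IsLawInvariant 𝒳 ρ) {g : unitInterval → ℝ}
    (hg : IsConcaveDistortion g) (hd : IsDominated P 𝒳 ρ g) (s t : unitInterval) :
    dist (g s) (g t) ≤ assocDistortion 𝒳 ρ |dist s t| := by
  rw [abs_of_nonneg dist_nonneg]
  refine (hg.dist_le_ext01 s t).trans (hd.ext01_le_assocDistortion hP h𝒳 hlaw ⟨dist_nonneg, ?_⟩)
  rw [Subtype.dist_eq]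
  exact Real.dist_le_of_mem_Icc_01 s.2 t.2

theorem IsConcaveDistortion.continuous_of_isDominated [IsProbabilityMeasure P]
    (hP : IsAtomless P) (h𝒳 : ContainsLinfty 𝒳) (hcoh : IsCoherent 𝒳 ρ)
    (hlaw : IsLawInvariant 𝒳 ρ) (hb : Tendsto (assocDistortion 𝒳 ρ) (𝓝[>] 0) (𝓝 0))
    {g : unitInterval → ℝ} (hg : IsConcaveDistortion g) (hd : IsDominated P 𝒳 ρ g) :
    Continuous g :=
  (Metric.equicontinuous_of_continuity_modulus _ (tendsto_assocDistortion_abs hcoh hlaw hb)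
    (fun _ : Unit => g) fun s t _ => hg.dist_le_assocDistortion hP h𝒳 hlaw hd s t).continuous ()

theorem isClosed_dominatedDistortions [IsProbabilityMeasure P] :
    IsClosed (dominatedDistortions P 𝒳 ρ) := by
  -- Concavity is repeated in every factor because the integral is shown continuous only on the
  -- distortions; `Y = 0`, `M = 0` recovers it.
  have : dominatedDistortions P 𝒳 ρ = ⋂ (Y : 𝒳) (_ : 0 ≤ᵐ[P] (Y : Lp ℝ 1 P)) (M : ℕ),
      {g : C(unitInterval, ℝ) | IsConcaveDistortion g} ∩
        (fun g => ∫ x in Ioc (0 : ℝ) M, (0 + 1 * ext01 g (P.real {ω | x < (Y : Lp ℝ 1 P) ω}))) ⁻¹'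
          Iic (ρ (-Y)) := by
    ext g
    simp only [mem_iInter, zero_add, one_mul]
    constructor
    · intro h Y hY M
      refine ⟨h.1, ?_⟩
      rw [mem_preimage, ← intervalIntegral.integral_of_le M.cast_nonneg]
      exact h.2 Y hY M
    · intro h
      refine ⟨(h 0 (Lp.coeFn_zero ℝ 1 P).symm.le 0).1, fun Y hY M => ?_⟩
      have := (h Y hY M).2
      rwa [mem_preimage, ← intervalIntegral.integral_of_le M.cast_nonneg] at this
  rw [this]
  refine isClosed_iInter fun Y => isClosed_iInter fun _ => isClosed_iInter fun M =>
    ContinuousOn.preimage_isClosed_of_isClosed ?_ isClosed_setOf_isConcaveDistortion isClosed_Iic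
  have hanti : Antitone fun x : ℝ => P.real {ω | x < (Y : Lp ℝ 1 P) ω} := fun _ _ hxy =>
    measureReal_mono fun _ hω => lt_of_le_of_lt hxy hω
  refine continuousOn_setIntegral_ext01 (b := fun _ => 1) hanti.measurable 0 1 measurableSet_Ioc
    (by simp) fun g hg x _ => ?_
  rw [zero_add, one_mul, abs_of_nonneg (IsConcaveDistortion.ext01_nonneg hg _)]
  exact IsConcaveDistortion.ext01_le_one hg _

theorem isCompact_dominatedDistortions [IsProbabilityMeasure P] (hP : IsAtomless P)
    (h𝒳 : ContainsLinfty 𝒳) (hcoh : IsCoherent 𝒳 ρ) (hlaw : IsLawInvariant 𝒳 ρ)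
    (hb : Tendsto (assocDistortion 𝒳 ρ) (𝓝[>] 0) (𝓝 0)) :
    IsCompact (dominatedDistortions P 𝒳 ρ) := by
  let e := (ContinuousMap.isometryEquivBoundedOfCompact unitInterval ℝ).toHomeomorph
  rw [← e.isCompact_image]
  refine BoundedContinuousFunction.arzela_ascoli₂ (Icc 0 1) isCompact_Icc _
    (e.isClosed_image.2 isClosed_dominatedDistortions) ?_ ?_
  · rintro _ t ⟨g, hg, rfl⟩
    exact ⟨hg.1.map_zero.ge.trans (hg.1.monotone unitInterval.nonneg'),
      (hg.1.monotone unitInterval.le_one').trans hg.1.map_one.le⟩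
  · refine Metric.equicontinuous_of_continuity_modulus _ (tendsto_assocDistortion_abs hcoh hlaw hb)
      _ ?_
    rintro s t ⟨_, g, hg, rfl⟩
    exact hg.1.dist_le_assocDistortion hP h𝒳 hlaw hg.2 s t

end

/-! ### Integrability and the representation of `ρ`. -/

section

theorem distFun_eq_real [IsProbabilityMeasure P] {f : Ω → ℝ} (hf : AEMeasurable f P) (x : ℝ) :
    distFun P f x = P.real {ω | f ω ≤ x} := by
  have := Measure.isProbabilityMeasure_map hf
  rw [distFun, cdf_eq_real, map_measureReal_apply_of_aemeasurable hf measurableSet_Iic]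
  rfl

theorem one_sub_distFun [IsProbabilityMeasure P] {f : Ω → ℝ} (hf : Measurable f) (x : ℝ) :
    1 - distFun P f x = P.real {ω | x < f ω} := by
  rw [distFun_eq_real hf.aemeasurable, ← probReal_compl_eq_one_sub
    (measurableSet_le hf measurable_const)]
  congr 1
  ext ω
  simp

theorem distFun_mem_Icc (P : Measure Ω) (f : Ω → ℝ) (x : ℝ) : distFun P f x ∈ Icc (0 : ℝ) 1 :=
  ⟨cdf_nonneg _ _, cdf_le_one _ _⟩

theorem monotone_distFun (P : Measure Ω) (f : Ω → ℝ) : Monotone (distFun P f) :=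
  monotone_cdf _

variable {𝒳 : Submodule ℝ (Lp ℝ 1 P)} {ρ : 𝒳 → ℝ}

theorem measurable_coe (X : 𝒳) : Measurable (X : Lp ℝ 1 P) :=
  (Lp.stronglyMeasurable _).measurable

/-- Cutting off `X` at `m` turns the domination integral into an integral of `g ∘ F_X`. -/
theorem integral_ext01_shift_eq [IsProbabilityMeasure P] (g : unitInterval → ℝ) {X Y : 𝒳}
    {m : ℝ} (hY : (Y : Lp ℝ 1 P) =ᵐ[P] fun ω => max (m - (X : Lp ℝ 1 P) ω) 0) (M : ℕ) :
    ∫ x in (0 : ℝ)..M, ext01 g (P.real {ω | x < (Y : Lp ℝ 1 P) ω}) =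
      ∫ x in (m - M)..m, ext01 g (distFun P (X : Lp ℝ 1 P) x) := by
  have h1 := intervalIntegral.integral_comp_sub_left (a := 0) (b := M)
    (fun y => ext01 g (distFun P (X : Lp ℝ 1 P) y)) m
  rw [sub_zero] at h1
  rw [← h1]
  refine intervalIntegral.integral_congr_ae ?_
  -- Strict and weak inequality differ only at atoms of the law, a Lebesgue null set of `x`.
  filter_upwards [meas_le_ae_eq_meas_lt P volume fun ω => m - (X : Lp ℝ 1 P) ω] with x hx hxM
  rw [uIoc_of_le M.cast_nonneg] at hxM
  rw [distFun_eq_real (measurable_coe X).aemeasurable]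
  congr 1
  calc P.real {ω | x < (Y : Lp ℝ 1 P) ω} = P.real {ω | x < m - (X : Lp ℝ 1 P) ω} := by
        refine measureReal_congr ?_
        filter_upwards [hY] with ω h
        refine propext (show x < (Y : Lp ℝ 1 P) ω ↔ x < m - (X : Lp ℝ 1 P) ω from ?_)
        rw [h, lt_max_iff, or_iff_left hxM.1.not_gt]
    _ = P.real {ω | x ≤ m - (X : Lp ℝ 1 P) ω} := by
        simp only [measureReal_def, hx]
    _ = P.real {ω | (X : Lp ℝ 1 P) ω ≤ m - x} := by
        congr 1
        ext ω
        exact (le_sub_comm : x ≤ m - (X : Lp ℝ 1 P) ω ↔ _)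

theorem ContainsLinfty.exists_ae_eq_const_sub [IsFiniteMeasure P] (h𝒳 : ContainsLinfty 𝒳)
    (hlat : IsStoneanLattice 𝒳) (X : 𝒳) (m : ℝ) :
    ∃ Y : 𝒳, (Y : Lp ℝ 1 P) =ᵐ[P] fun ω => max (m - (X : Lp ℝ 1 P) ω) 0 := by
  obtain ⟨Y, hY⟩ := h𝒳.exists_ae_eq_tail hlat (-X) (-m)
  refine ⟨Y, ?_⟩
  filter_upwards [hY, coe_neg_ae X] with ω h1 h2
  rw [h1, h2]
  congr 1
  ring

section Domain

variable {g : unitInterval → ℝ}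

theorem IsConcaveDistortion.monotone_ext01_distFun (hg : IsConcaveDistortion g) (f : Ω → ℝ) :
    Monotone fun x => ext01 g (distFun P f x) :=
  hg.ext01_mono.comp (monotone_distFun P f)

theorem integrableOn_ext01_tail_abs [IsProbabilityMeasure P] (hlat : IsStoneanLattice 𝒳)
    (hg : IsConcaveDistortion g) (hd : IsDominated P 𝒳 ρ g) (X : 𝒳) :
    IntegrableOn (fun x => ext01 g (1 - distFun P (fun ω => |(X : Lp ℝ 1 P) ω|) x)) (Ioi 0) := by
  have habs : |(X : Lp ℝ 1 P)| ∈ 𝒳 := (hlat _ X.2 _ (-X).2).2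
  have heq : (fun x => ext01 g (1 - distFun P (fun ω => |(X : Lp ℝ 1 P) ω|) x)) =
      fun x => ext01 g (P.real {ω | x < |(X : Lp ℝ 1 P)| ω}) := by
    funext x
    rw [one_sub_distFun (measurable_coe X).abs]
    congr 1
    refine measureReal_congr ?_
    filter_upwards [Lp.coeFn_abs (X : Lp ℝ 1 P)] with ω h
    refine propext (show x < |(X : Lp ℝ 1 P) ω| ↔ x < |(X : Lp ℝ 1 P)| ω from ?_)
    rw [h]
  rw [heq]
  have hanti := hg.antitone_ext01_meas (P := P) (|(X : Lp ℝ 1 P)| : Lp ℝ 1 P)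
  refine integrableOn_Ioi_of_intervalIntegral_norm_bounded (l := atTop) (b := fun M : ℕ => (M : ℝ))
    (ρ (-⟨_, habs⟩)) 0 (fun M => hanti.intervalIntegrable.1) tendsto_natCast_atTop_atTop
    (Eventually.of_forall fun M => ?_)
  simp_rw [Real.norm_of_nonneg (hg.ext01_nonneg _)]
  refine hd ⟨_, habs⟩ ?_ M
  filter_upwards [Lp.coeFn_abs (X : Lp ℝ 1 P)] with ω h
  exact (abs_nonneg _).trans_eq h.symm

theorem integrableOn_ext01_distFun [IsProbabilityMeasure P] (h𝒳 : ContainsLinfty 𝒳)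
    (hlat : IsStoneanLattice 𝒳)
    (hg : IsConcaveDistortion g) (hd : IsDominated P 𝒳 ρ g) (X : 𝒳) (m : ℝ) :
    IntegrableOn (fun x => ext01 g (distFun P (X : Lp ℝ 1 P) x)) (Iic m) := by
  obtain ⟨Y, hY⟩ := h𝒳.exists_ae_eq_const_sub hlat X m
  refine integrableOn_Iic_of_intervalIntegral_norm_bounded (l := atTop)
    (a := fun M : ℕ => m - (M : ℝ)) (ρ (-Y)) m
    (fun M => (hg.monotone_ext01_distFun _).intervalIntegrable.1)
    (tendsto_atBot_add_const_left _ m (tendsto_neg_atTop_atBot.comp tendsto_natCast_atTop_atTop))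
    (Eventually.of_forall fun M => ?_)
  simp_rw [Real.norm_of_nonneg (hg.ext01_nonneg _)]
  rw [← integral_ext01_shift_eq g hY M]
  refine hd Y ?_ M
  filter_upwards [hY] with ω h
  exact (le_max_right _ _).trans_eq h.symm

/-- Since `t ≤ g t`, the integrable `g`-tail of `|X|` majorizes `1 - F_X`, which in turn majorizes
`1 - g(F_X)` for every distortion `g`. -/
theorem integrableOn_one_sub_distFun [IsProbabilityMeasure P] (hlat : IsStoneanLattice 𝒳)
    (hg : IsConcaveDistortion g) (hd : IsDominated P 𝒳 ρ g) (X : 𝒳) :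
    IntegrableOn (fun x => 1 - distFun P (X : Lp ℝ 1 P) x) (Ioi 0) := by
  refine (integrableOn_ext01_tail_abs hlat hg hd X).mono'
    (measurable_const.sub (monotone_distFun P _).measurable).aestronglyMeasurable
    (Eventually.of_forall fun x => ?_)
  have h1 := distFun_mem_Icc P (X : Lp ℝ 1 P) x
  have h2 : 1 - distFun P (X : Lp ℝ 1 P) x ≤ 1 - distFun P (fun ω => |(X : Lp ℝ 1 P) ω|) x := by
    rw [one_sub_distFun (measurable_coe X), one_sub_distFun (measurable_coe X).abs]
    exact measureReal_mono fun ω hω =>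
      show x < |(X : Lp ℝ 1 P) ω| from lt_of_lt_of_le hω (le_abs_self _)
  rw [Real.norm_of_nonneg (sub_nonneg.2 h1.2)]
  exact (hg.le_ext01 ⟨sub_nonneg.2 h1.2, by linarith [h1.1]⟩).trans (hg.ext01_mono h2)

theorem IsConcaveDistortion.one_sub_ext01_le (hg : IsConcaveDistortion g) (f : Ω → ℝ) (x : ℝ) :
    ‖1 - ext01 g (distFun P f x)‖ ≤ 1 - distFun P f x := by
  rw [Real.norm_of_nonneg (sub_nonneg.2 (hg.ext01_le_one _))]
  linarith [hg.le_ext01 (distFun_mem_Icc P f x)]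

theorem inDistortionDomain_of_isDominated [IsProbabilityMeasure P] (h𝒳 : ContainsLinfty 𝒳)
    (hlat : IsStoneanLattice 𝒳)
    (hg : IsConcaveDistortion g) (hd : IsDominated P 𝒳 ρ g) (X : 𝒳) :
    InDistortionDomain P g (X : Lp ℝ 1 P) :=
  ⟨integrableOn_ext01_tail_abs hlat hg hd X, integrableOn_ext01_distFun h𝒳 hlat hg hd X 0,
    (integrableOn_one_sub_distFun hlat hg hd X).mono'
      (measurable_const.sub (hg.monotone_ext01_distFun _).measurable).aestronglyMeasurable
      (Eventually.of_forall fun x => hg.one_sub_ext01_le _ x)⟩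

/-- The term `m` is the integral of `1` over `[0, m]`. In this form `ρ_g(X)` can be compared with
`ρ(-(m - X)⁺) - m`. -/
theorem tendsto_integral_sub_natCast [IsProbabilityMeasure P] (h𝒳 : ContainsLinfty 𝒳)
    (hlat : IsStoneanLattice 𝒳)
    (hg : IsConcaveDistortion g) (hd : IsDominated P 𝒳 ρ g) (X : 𝒳) :
    Tendsto (fun m : ℕ => (∫ x in Iic (m : ℝ), ext01 g (distFun P (X : Lp ℝ 1 P) x)) - m) atTop
      (𝓝 (distortionRisk P g (X : Lp ℝ 1 P))) := by
  have h := (inDistortionDomain_of_isDominated h𝒳 hlat hg hd X).2.2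
  have hlim := (intervalIntegral_tendsto_integral_Ioi (0 : ℝ) h
    (tendsto_natCast_atTop_atTop (R := ℝ))).const_sub
      (∫ x in Iic (0 : ℝ), ext01 g (distFun P (X : Lp ℝ 1 P) x))
  refine hlim.congr fun m => ?_
  have h1 := intervalIntegral.integral_Iic_sub_Iic
    (integrableOn_ext01_distFun h𝒳 hlat hg hd X 0) (integrableOn_ext01_distFun h𝒳 hlat hg hd X m)
  rw [intervalIntegral.integral_sub intervalIntegrable_const
    (hg.monotone_ext01_distFun _).intervalIntegrable]
  simp only [intervalIntegral.integral_const, sub_zero, smul_eq_mul, mul_one]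
  linarith

theorem tendsto_integral_Iic [IsProbabilityMeasure P] (h𝒳 : ContainsLinfty 𝒳)
    (hlat : IsStoneanLattice 𝒳)
    (hg : IsConcaveDistortion g) (hd : IsDominated P 𝒳 ρ g) (X : 𝒳) (m : ℝ) :
    Tendsto (fun M : ℕ => ∫ x in (m - M)..m, ext01 g (distFun P (X : Lp ℝ 1 P) x)) atTop
      (𝓝 (∫ x in Iic m, ext01 g (distFun P (X : Lp ℝ 1 P) x))) :=
  intervalIntegral_tendsto_integral_Iic m (integrableOn_ext01_distFun h𝒳 hlat hg hd X m)
    (tendsto_atBot_add_const_left _ m (tendsto_neg_atTop_atBot.comp tendsto_natCast_atTop_atTop))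

theorem TailCondition.exists_tail [IsFiniteMeasure P] (h𝒳 : ContainsLinfty 𝒳)
    (hlat : IsStoneanLattice 𝒳) (ha : TailCondition 𝒳 ρ) (X : 𝒳) :
    ∃ T : ℕ → 𝒳,
      (∀ k : ℕ, (T k : Lp ℝ 1 P) =ᵐ[P] fun ω => max ((X : Lp ℝ 1 P) ω - k) 0) ∧
      Tendsto (fun k => ρ (-T k)) atTop (𝓝 0) := by
  choose T hT using fun k : ℕ => h𝒳.exists_ae_eq_tail hlat X k
  obtain ⟨X₀, hX₀⟩ := h𝒳.exists_ae_eq_tail hlat X 0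
  -- Condition (a) needs a nonnegative variable; `(X - k)⁺ = (X⁺ - k)⁺` for `k ≥ 0`.
  refine ⟨T, hT, ha X₀ T ?_ fun k => ?_⟩
  · rw [← Lp.coeFn_nonneg]
    filter_upwards [hX₀] with ω h
    rw [h]
    exact le_max_right _ _
  · filter_upwards [hT k, hX₀] with ω h1 h2
    have hk : (0 : ℝ) ≤ k := k.cast_nonneg
    rw [h1, h2, sub_zero]
    rcases le_total ((X : Lp ℝ 1 P) ω) 0 with h | h
    · rw [max_eq_right h, max_eq_right (by linarith), max_eq_right (by linarith)]
    · rw [max_eq_left h]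

/-- Write `(m - X)⁺ = m - X + (X - m)⁺`: domination, cash invariance and subadditivity bound the
integral up to `m` by `m + ρ X + ρ(-(X - m)⁺)`, and the last term vanishes by (a). -/
theorem distortionRisk_le [IsProbabilityMeasure P] (h𝒳 : ContainsLinfty 𝒳)
    (hlat : IsStoneanLattice 𝒳) (hcoh : IsCoherent 𝒳 ρ) (ha : TailCondition 𝒳 ρ)
    (hg : IsConcaveDistortion g) (hd : IsDominated P 𝒳 ρ g) (X : 𝒳) :
    distortionRisk P g (X : Lp ℝ 1 P) ≤ ρ X := by
  obtain ⟨T, hT, hlim⟩ := TailCondition.exists_tail h𝒳 hlat ha X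
  have hlim' := hlim.const_add (ρ X)
  rw [add_zero] at hlim'
  refine le_of_tendsto_of_tendsto' (tendsto_integral_sub_natCast h𝒳 hlat hg hd X) hlim'
    fun m => ?_
  obtain ⟨Y, hY⟩ := h𝒳.exists_ae_eq_const_sub hlat X m
  have h1 : ∫ x in Iic (m : ℝ), ext01 g (distFun P (X : Lp ℝ 1 P) x) ≤ ρ (-Y) := by
    refine le_of_tendsto' (tendsto_integral_Iic h𝒳 hlat hg hd X m) fun M => ?_
    rw [← integral_ext01_shift_eq g hY M]
    refine hd Y ?_ M
    filter_upwards [hY] with ω h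
    exact (le_max_right _ _).trans_eq h.symm
  have h2 : ρ (-Y) = ρ (-(-X + T m)) + m := by
    refine hcoh.neg_add_const ?_
    filter_upwards [hY, hT m, coe_neg_ae X, coe_add_ae (-X) (T m)] with ω h1 h2 h3 h4
    rw [h1, h4, h3, h2]
    rcases le_total ((X : Lp ℝ 1 P) ω) m with h | h
    · rw [max_eq_left (by linarith), max_eq_right (by linarith)]
      ring
    · rw [max_eq_right (by linarith), max_eq_left (by linarith)]
      ring
  have h3 := hcoh.subadditive X (-T m)
  rw [neg_add, neg_neg] at h2
  linarith

end Domain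

theorem IsCoherent.map_const (hcoh : IsCoherent 𝒳 ρ) {C : 𝒳} {m : ℝ}
    (hC : (C : Lp ℝ 1 P) =ᵐ[P] fun _ => m) : ρ C = -m := by
  rw [hcoh.cash_invariant 0 C m, hcoh.map_zero, zero_sub]
  filter_upwards [hC, Lp.coeFn_zero ℝ 1 P] with ω h1 h2
  rw [h1, Submodule.coe_zero, h2, Pi.zero_apply, zero_add]

/-- With `Y = (m - X)⁺` one has `X + Y ≥ m`, so `ℓ (X + Y) ≥ m` and `ρ X = -ℓ X ≤ ℓ Y - m`; the
upper bound on `ℓ Y` then gives the integral of `g(F_X)` up to `m`. -/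
theorem exists_le_distortionRisk [IsProbabilityMeasure P] (hP : IsAtomless P)
    (h𝒳 : ContainsLinfty 𝒳) (hlat : IsStoneanLattice 𝒳) (hcoh : IsCoherent 𝒳 ρ)
    (hlaw : IsLawInvariant 𝒳 ρ) (ha : TailCondition 𝒳 ρ)
    (hb : Tendsto (assocDistortion 𝒳 ρ) (𝓝[>] 0) (𝓝 0)) (X : 𝒳) :
    ∃ g : unitInterval → ℝ, IsConcaveDistortion g ∧ IsDominated P 𝒳 ρ g ∧
      ρ X ≤ distortionRisk P g (X : Lp ℝ 1 P) := by
  obtain ⟨ℓ, hℓX, hℓ⟩ := hcoh.exists_dominated_linear X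
  obtain ⟨g, hg, hd, hbound⟩ := exists_isDominated_of_linear hP h𝒳 hcoh hlaw hb hℓ
  refine ⟨g, hg, hd, ge_of_tendsto' (tendsto_integral_sub_natCast h𝒳 hlat hg hd X) fun m => ?_⟩
  obtain ⟨Y, hY⟩ := h𝒳.exists_ae_eq_const_sub hlat X m
  have hY0 : 0 ≤ᵐ[P] (Y : Lp ℝ 1 P) := by
    filter_upwards [hY] with ω h
    exact (le_max_right _ _).trans_eq h.symm
  obtain ⟨T, hT, hlim⟩ := TailCondition.exists_tail h𝒳 hlat ha Y
  have h1 : ℓ Y ≤ ∫ x in Iic (m : ℝ), ext01 g (distFun P (X : Lp ℝ 1 P) x) := by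
    have hlim' := (tendsto_integral_Iic h𝒳 hlat hg hd X m).add hlim
    rw [add_zero] at hlim'
    refine ge_of_tendsto' hlim' fun M => ?_
    rw [← integral_ext01_shift_eq g hY M]
    exact hbound Y (T M) M hY0 (hT M)
  obtain ⟨C, hC⟩ := h𝒳.exists_ae_eq (memLp_const (μ := P) (p := ⊤) (m : ℝ))
  have h2 : ρ (X + Y) ≤ ρ C := by
    refine hcoh.antitone _ _ ((Lp.coeFn_le _ _).1 ?_)
    filter_upwards [hC, hY, coe_add_ae X Y] with ω h1 h2 h3
    rw [h1, h3, h2]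
    linarith [le_max_left ((m : ℝ) - (X : Lp ℝ 1 P) ω) 0]
  rw [hcoh.map_const hC] at h2
  have h3 := hℓ (-(X + Y))
  rw [neg_neg, map_neg, map_add, hℓX] at h3
  linarith

theorem distortionRisk_neg_indicator [IsProbabilityMeasure P] {g : unitInterval → ℝ}
    (hg0 : g 0 = 0) (hg1 : g 1 = 1) {A : Set Ω} {Y : 𝒳}
    (hY : (Y : Lp ℝ 1 P) =ᵐ[P] A.indicator fun _ => (1 : ℝ)) :
    distortionRisk P g ((-Y : 𝒳) : Lp ℝ 1 P) = ext01 g (P.real A) := by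
  have hF : ∀ x, distFun P ((-Y : 𝒳) : Lp ℝ 1 P) x =
      P.real {ω | -(A.indicator (fun _ => (1 : ℝ)) ω) ≤ x} := by
    intro x
    rw [distFun_eq_real (measurable_coe _).aemeasurable]
    refine measureReal_congr ?_
    filter_upwards [hY, coe_neg_ae Y] with ω h1 h2
    refine propext (show ((-Y : 𝒳) : Lp ℝ 1 P) ω ≤ x ↔
      -(A.indicator (fun _ => (1 : ℝ)) ω) ≤ x from ?_)
    rw [h2, h1]
  have hpos : ∀ x ∈ Ioi (0 : ℝ), 1 - ext01 g (distFun P ((-Y : 𝒳) : Lp ℝ 1 P) x) = 0 := by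
    intro x hx
    have : {ω | -(A.indicator (fun _ => (1 : ℝ)) ω) ≤ x} = univ :=
      eq_univ_of_forall fun ω => show -(A.indicator (fun _ => (1 : ℝ)) ω) ≤ x from
        (neg_nonpos.2 (indicator_nonneg (fun _ _ => zero_le_one) ω)).trans (le_of_lt hx)
    rw [hF, this, probReal_univ, ext01_one, hg1, sub_self]
  have hneg : ∀ x ∈ Iio (0 : ℝ), ext01 g (distFun P ((-Y : 𝒳) : Lp ℝ 1 P) x) =
      (Ico (-1) 0).indicator (fun _ => ext01 g (P.real A)) x := by
    intro x hx
    rw [hF]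
    by_cases h : -1 ≤ x
    · rw [indicator_of_mem (show x ∈ Ico (-1) 0 from ⟨h, hx⟩)]
      congr 2
      ext ω
      by_cases hω : ω ∈ A
      · simp [hω, h]
      · simpa [hω] using hx
    · rw [indicator_of_notMem fun h' => h h'.1]
      have : {ω | -(A.indicator (fun _ => (1 : ℝ)) ω) ≤ x} = ∅ := by
        refine eq_empty_of_forall_notMem fun ω hω => h (le_trans (neg_le_neg ?_) hω)
        exact indicator_apply_le' (fun _ => le_rfl) fun _ => zero_le_one
      rw [this, measureReal_empty, ext01_zero, hg0]
  rw [distortionRisk, setIntegral_congr_fun measurableSet_Ioi hpos, integral_Iic_eq_integral_Iio,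
    setIntegral_congr_fun measurableSet_Iio hneg, setIntegral_indicator measurableSet_Ico,
    inter_eq_right.2 fun x hx => hx.2]
  simp

end

/-! ### Semicontinuity and continuity in `g`. -/

section

variable {𝒳 : Submodule ℝ (Lp ℝ 1 P)} {ρ : 𝒳 → ℝ}

theorem continuousOn_integral_one_sub_ext01 [IsProbabilityMeasure P] (hlat : IsStoneanLattice 𝒳)
    (X : 𝒳) :
    ContinuousOn (fun g : C(unitInterval, ℝ) =>
      ∫ x in Ioi (0 : ℝ), (1 - ext01 g (distFun P (X : Lp ℝ 1 P) x)))
      (dominatedDistortions P 𝒳 ρ) := by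
  -- Integrability of the majorant `1 - F_X` is deduced from the existence of some dominated
  -- distortion, here `g₀`.
  intro g₀ hg₀
  have h := continuousOn_setIntegral_ext01 (S := dominatedDistortions P 𝒳 ρ)
    (monotone_distFun P (X : Lp ℝ 1 P)).measurable 1 (-1) measurableSet_Ioi
    (integrableOn_one_sub_distFun hlat hg₀.1 hg₀.2 X) fun g hg x _ => by
      rw [neg_one_mul, ← sub_eq_add_neg]
      exact hg.1.one_sub_ext01_le _ x
  simp only [neg_one_mul, ← sub_eq_add_neg] at h
  exact h g₀ hg₀

/-- Restricting the negative half-line to `(-M, 0]` gives functions continuous in `g` that lie below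
`ρ_g(X)` and converge to it. -/
theorem lowerSemicontinuousOn_distortionRisk [IsProbabilityMeasure P] (h𝒳 : ContainsLinfty 𝒳)
    (hlat : IsStoneanLattice 𝒳) (X : 𝒳) :
    LowerSemicontinuousOn
      (fun g : C(unitInterval, ℝ) => distortionRisk P g (X : Lp ℝ 1 P))
      (dominatedDistortions P 𝒳 ρ) := by
  have hcont : ∀ M : ℕ, ContinuousOn (fun g : C(unitInterval, ℝ) =>
      (∫ x in Ioc (-M : ℝ) 0, (0 + 1 * ext01 g (distFun P (X : Lp ℝ 1 P) x))) -
        ∫ x in Ioi (0 : ℝ), (1 - ext01 g (distFun P (X : Lp ℝ 1 P) x)))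
      (dominatedDistortions P 𝒳 ρ) := fun M =>
    (continuousOn_setIntegral_ext01 (b := fun _ => 1) (monotone_distFun P _).measurable 0 1
      measurableSet_Ioc (by simp) fun g hg x _ => by
        rw [zero_add, one_mul, abs_of_nonneg (hg.1.ext01_nonneg _)]
        exact hg.1.ext01_le_one _).sub (continuousOn_integral_one_sub_ext01 hlat X)
  have hle : ∀ g ∈ dominatedDistortions P 𝒳 ρ, ∀ M : ℕ,
      (∫ x in Ioc (-M : ℝ) 0, (0 + 1 * ext01 g (distFun P (X : Lp ℝ 1 P) x))) -
        (∫ x in Ioi (0 : ℝ), (1 - ext01 g (distFun P (X : Lp ℝ 1 P) x))) ≤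
        distortionRisk P g (X : Lp ℝ 1 P) := by
    intro g hg M
    simp only [zero_add, one_mul]
    exact sub_le_sub_right (setIntegral_mono_set
      (integrableOn_ext01_distFun h𝒳 hlat hg.1 hg.2 X 0)
      (Eventually.of_forall fun x => hg.1.ext01_nonneg _) Ioc_subset_Iic_self.eventuallyLE) _
  intro g hg y hy
  have hlim := (tendsto_integral_Iic h𝒳 hlat hg.1 hg.2 X 0).sub_const
    (∫ x in Ioi (0 : ℝ), (1 - ext01 g (distFun P (X : Lp ℝ 1 P) x)))
  obtain ⟨M, hM⟩ := (hlim.eventually_const_lt (show y < _ from hy)).exists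
  rw [zero_sub, intervalIntegral.integral_of_le (by simp)] at hM
  have hev := ((hcont M) g hg).eventually_const_lt (show y < _ by simpa using hM)
  filter_upwards [hev, self_mem_nhdsWithin] with g' h1 h2
  exact h1.trans_le (hle g' h2 M)

/-- The majorant `γ⁻¹ g_ρ(γ F_X)` of `g(F_X)` is uniform in `g`, so dominated convergence applies.
-/
theorem continuousOn_distortionRisk [IsProbabilityMeasure P] (hP : IsAtomless P)
    (h𝒳 : ContainsLinfty 𝒳) (hlat : IsStoneanLattice 𝒳) (hlaw : IsLawInvariant 𝒳 ρ) (X : 𝒳)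
    {γ : ℝ} (hγ : γ ∈ Ioo (0 : ℝ) 1)
    (hint : IntegrableOn (fun x => assocDistortion 𝒳 ρ (γ * distFun P (X : Lp ℝ 1 P) x))
      (Iic 0)) :
    ContinuousOn (fun g : C(unitInterval, ℝ) => distortionRisk P g (X : Lp ℝ 1 P))
      (dominatedDistortions P 𝒳 ρ) := by
  have h := continuousOn_setIntegral_ext01 (S := dominatedDistortions P 𝒳 ρ)
    (monotone_distFun P (X : Lp ℝ 1 P)).measurable 0 1 measurableSet_Iic
    (hint.const_mul γ⁻¹) fun g hg x _ => by
      have hF := distFun_mem_Icc P (X : Lp ℝ 1 P) x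
      have h1 := hg.1.mul_le_ext01 ⟨hγ.1.le, hγ.2.le⟩ hF
      have h2 := hg.2.ext01_le_assocDistortion hP h𝒳 hlaw
        (t := γ * distFun P (X : Lp ℝ 1 P) x)
        ⟨mul_nonneg hγ.1.le hF.1, mul_le_one₀ hγ.2.le hF.1 hF.2⟩
      rw [zero_add, one_mul, abs_of_nonneg (hg.1.ext01_nonneg _), ← div_eq_inv_mul,
        le_div_iff₀' hγ.1]
      exact h1.trans h2
  simp only [zero_add, one_mul] at h
  exact h.sub (continuousOn_integral_one_sub_ext01 hlat X)

end

end CoherentRisk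

/-! ### The main theorem. -/

theorem mainTheorem5 {Ω : Type*} [MeasurableSpace Ω] (P : Measure Ω) [IsProbabilityMeasure P]
    (hP : IsAtomless P)
    (𝒳 : Submodule ℝ (Lp ℝ 1 P)) (h𝒳 : ContainsLinfty 𝒳) (hlat : IsStoneanLattice 𝒳)
    (ρ : 𝒳 → ℝ) (hcoh : IsCoherent 𝒳 ρ) (hlaw : IsLawInvariant 𝒳 ρ)
    (ha : TailCondition 𝒳 ρ)
    (hb : Tendsto (assocDistortion 𝒳 ρ) (𝓝[>] 0) (𝓝 0)) :
    ∃ G : Set C(unitInterval, ℝ),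
      (∀ g ∈ G, IsConcaveDistortion g) ∧
      IsCompact G ∧
      (∀ t : unitInterval, IsLUB ((fun g : C(unitInterval, ℝ) => g t) '' G)
        (assocDistortion 𝒳 ρ t)) ∧
      (∀ γ ∈ Ioo (0 : ℝ) 1, ∀ t ∈ Ioo (0 : ℝ) 1, ∀ g ∈ G,
        DifferentiableWithinAt ℝ (ext01 g) (Ioi t) t ∧
        derivWithin (ext01 g) (Ioi t) t ≤ assocDistortion 𝒳 ρ (γ * t) / (γ * t)) ∧
      (∀ X : 𝒳, (∀ g ∈ G, InDistortionDomain P g (X : Lp ℝ 1 P)) ∧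
        IsLUB ((fun g : C(unitInterval, ℝ) => distortionRisk P g (X : Lp ℝ 1 P)) '' G) (ρ X)) ∧
      (∀ X : 𝒳,
        LowerSemicontinuousOn
          (fun g : C(unitInterval, ℝ) => distortionRisk P g (X : Lp ℝ 1 P)) G ∧
        ((∃ γ ∈ Ioo (0 : ℝ) 1,
            IntegrableOn (fun x => assocDistortion 𝒳 ρ (γ * distFun P (X : Lp ℝ 1 P) x)) (Iic 0)) →
          ContinuousOn
            (fun g : C(unitInterval, ℝ) => distortionRisk P g (X : Lp ℝ 1 P)) G)) := by
  -- Both suprema are maxima: (iv) directly, and (ii) by taking the negative of an indicator.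
  have hattain : ∀ X : 𝒳, ∃ g ∈ dominatedDistortions P 𝒳 ρ,
      distortionRisk P g (X : Lp ℝ 1 P) = ρ X := by
    intro X
    obtain ⟨g, hg, hd, hle⟩ := exists_le_distortionRisk hP h𝒳 hlat hcoh hlaw ha hb X
    exact ⟨⟨g, hg.continuous_of_isDominated hP h𝒳 hcoh hlaw hb hd⟩, ⟨hg, hd⟩,
      (distortionRisk_le h𝒳 hlat hcoh ha hg hd X).antisymm hle⟩
  refine ⟨dominatedDistortions P 𝒳 ρ, fun g hg => hg.1,
    isCompact_dominatedDistortions hP h𝒳 hcoh hlaw hb, fun t => ?_, fun γ hγ t ht g hg => ⟨?_, ?_⟩,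
    fun X => ⟨fun g hg => inDistortionDomain_of_isDominated h𝒳 hlat hg.1 hg.2 X, ?_⟩,
    fun X => ⟨lowerSemicontinuousOn_distortionRisk h𝒳 hlat X, fun ⟨γ, hγ, hint⟩ =>
      continuousOn_distortionRisk hP h𝒳 hlat hlaw X hγ hint⟩⟩
  · refine ⟨?_, fun b hub => ?_⟩
    · rintro _ ⟨g, hg, rfl⟩
      have := hg.2.ext01_le_assocDistortion hP h𝒳 hlaw t.2
      rwa [ext01_of_mem t.2] at this
    · obtain ⟨A, hA, hAt⟩ := hP.exists_real_eq t.2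
      obtain ⟨Y, hY⟩ := h𝒳.exists_ae_eq_indicator hA
      obtain ⟨g, hg, heq⟩ := hattain (-Y)
      rw [distortionRisk_neg_indicator hg.1.map_zero hg.1.map_one hY,
        ← assocDistortion_real_eq hlaw hA hY, hAt, ext01_of_mem t.2] at heq
      exact hub ⟨g, hg, heq⟩
  · exact hg.1.differentiableWithinAt_Ioi ht
  · have h1 := hg.1.mul_le_ext01 ⟨hγ.1.le, hγ.2.le⟩ ⟨ht.1.le, ht.2.le⟩
    have h2 := hg.2.ext01_le_assocDistortion hP h𝒳 hlaw (t := γ * t)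
      ⟨mul_nonneg hγ.1.le ht.1.le, mul_le_one₀ hγ.2.le ht.1.le ht.2.le⟩
    refine (hg.1.derivWithin_Ioi_le ht).trans ?_
    rw [div_le_div_iff₀ ht.1 (mul_pos hγ.1 ht.1)]
    nlinarith [ht.1]
  · refine ⟨?_, fun b hub => ?_⟩
    · rintro _ ⟨g, hg, rfl⟩
      exact distortionRisk_le h𝒳 hlat hcoh ha hg.1 hg.2 X
    · obtain ⟨g, hg, heq⟩ := hattain X
      exact hub ⟨g, hg, heq⟩
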